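/- Let $n\ge 2$ and let $Q\subset\mathbb{R}^n$ be a convex compact set that contains a Euclidean ball of radius $\rho>0$. Let $\xi$ be a random element, and let $f(x)=\mathbb{E}f(x,\xi)$ be (finite,) continuous and convex on $Q$. Put $D=\sup_{x,y\in Q}\|x-y\|$, $B=\sup_{x,y\in Q}|f(x)-f(y)|$, where $\|\cdot\|$ is the Euclidean norm. For $\delta\ge0$, a vector $g$ is a $\delta$-subgradient of $f$ at $x\in Q$ if $f(y)\ge f(x)+\langle g,y-x\rangle-\delta$ for all $y\in Q$; a subgradient is a $0$-subgradient, and $\partial f(x)$ is the set of subgradients at $x$. Let $\partial_xf(x,\xi)\in\mathbb{R}^n$ be a stochastic oracle, jointly measurable in $(x,\xi)$, such that for some $\sigma>0$ and every $x\in Q$ $$\mathbb{E}_\xi\,\partial_xf(x,\xi)\in\partial f(x),\qquad \mathbb{E}_\xi\exp\!\left(\frac{\|\partial_xf(x,\xi)-g\|^2}{\sigma^2}\right)\le e\quad\text{for some } g\in\partial f(x).$$ The ellipsoid method with batch size $r$, $N$ iterations and starting ball $\{x:\|x-c\|\le R\}\supseteq Q$ is the following. Put $c_0=c$, $H_0=R^2I_n$.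 For $k=0,\dots,N-1$: if $c_k\in Q$, let $w_k=\frac1r\sum_{l=1}^r\partial_xf(c_k,\xi^{k,l})$, with independent realizations $\xi^{k,l}$ of $\xi$ that are fresh at every step, and if $w_k=0$ stop and return $c_k$; if $c_k\notin Q$, let $w_k\ne0$ be a vector, given by an arbitrary measurable separation oracle as a function of $(c_k,H_k)$, such that $\langle w_k,x-c_k\rangle\le0$ for all $x\in Q$ with $(x-c_k)^{T}H_k^{-1}(x-c_k)\le1$. Then put $$c_{k+1}=c_k-\frac1{n+1}\frac{H_kw_k}{\sqrt{w_k^{T}H_kw_k}},\qquad H_{k+1}=\frac{n^2}{n^2-1}\left(H_k-\frac2{n+1}\frac{H_kw_kw_k^{T}H_k}{w_k^{T}H_kw_k}\right).$$ If the method has not stopped earlier, it returns a minimizer of $f$ over $\{c_0,\dots,c_N\}\cap Q$. There is an absolute constant $C>0$ such that, for all such data, all $0<\varepsilon\le B$ and $\beta\in(0,1)$, the following holds with $$N=\left\lfloor 2n^2\ln\frac{DB}{\rho\varepsilon}\right\rfloor .$$ One has $1\le N\le 2n^2\ln\frac{DB}{\rho\varepsilon}$; there is a ball of radius $R\le\frac{\sqrt3}{2}D$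 that contains $Q$; and for every such starting ball and every batch size $$r\ \ge\ C\,\frac{\sigma^2D^2}{\varepsilon^2}\left(1+\ln\frac N\beta\right)$$ (so that $r=\widetilde O(\sigma^2D^2/\varepsilon^2)$ suffices), the ellipsoid method with $N$ iterations always returns a point, and every returned point $x^N\in Q$ (however ties between minimizers are broken) is an $(\varepsilon,\beta)$-solution of $\min_{x\in Q}f(x)$: $$\mathbb{P}\Big\{f(x^N)-\min_{x\in Q}f(x)>\varepsilon\Big\}\le\beta .$$ -/

import Mathlib

open MeasureTheory ProbabilityTheory

noncomputable section

namespace StochEllipsoid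

/-- The vector `g` is a `δ`-subgradient at `x` of the function `f` considered on the set `Q`. -/
def IsDeltaSubgradient {n : ℕ} (Q : Set (EuclideanSpace ℝ (Fin n)))
    (f : EuclideanSpace ℝ (Fin n) → ℝ) (δ : ℝ) (x g : EuclideanSpace ℝ (Fin n)) : Prop :=
  ∀ y ∈ Q, f y ≥ f x + inner ℝ g (y - x) - δ

/-- A subgradient is a `0`-subgradient. -/
def IsSubgradient {n : ℕ} (Q : Set (EuclideanSpace ℝ (Fin n)))
    (f : EuclideanSpace ℝ (Fin n) → ℝ) (x g : EuclideanSpace ℝ (Fin n)) : Prop :=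
  IsDeltaSubgradient Q f 0 x g

/-- The objective `f(x) = 𝔼 f(x, ξ)`, where `ξ` has law `P`. -/
def expectedValue {n : ℕ} {Ξ : Type*} [MeasurableSpace Ξ] (P : Measure Ξ)
    (F : EuclideanSpace ℝ (Fin n) → Ξ → ℝ) (x : EuclideanSpace ℝ (Fin n)) : ℝ :=
  ∫ z, F x z ∂P

/-- The stochastic oracle `G x ξ` is jointly measurable, its mean at every point of `Q` is a
subgradient of `f`, and its deviation from some subgradient of `f` is light-tailed
with parameter `σ`. -/
structure IsStochasticOracle {n : ℕ} {Ξ : Type*} [MeasurableSpace Ξ] (P : Measure Ξ)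
    (Q : Set (EuclideanSpace ℝ (Fin n))) (f : EuclideanSpace ℝ (Fin n) → ℝ) (σ : ℝ)
    (G : EuclideanSpace ℝ (Fin n) → Ξ → EuclideanSpace ℝ (Fin n)) : Prop where
  measurable : Measurable fun p : EuclideanSpace ℝ (Fin n) × Ξ => G p.1 p.2
  mean : ∀ x ∈ Q, IsSubgradient Q f x (∫ z, G x z ∂P)
  lightTail : ∀ x ∈ Q, ∃ g, IsSubgradient Q f x g ∧
    ∫⁻ z, ENNReal.ofReal (Real.exp (‖G x z - g‖ ^ 2 / σ ^ 2)) ∂P ≤ ENNReal.ofReal (Real.exp 1)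

/-- The minibatch average `(1 / r) ∑ G x ξˡ` over a batch of `r` realizations. -/
def minibatch {n : ℕ} {Ξ : Type*} (G : EuclideanSpace ℝ (Fin n) → Ξ → EuclideanSpace ℝ (Fin n))
    (r : ℕ) (z : ℕ → Ξ) (x : EuclideanSpace ℝ (Fin n)) : EuclideanSpace ℝ (Fin n) :=
  (1 / (r : ℝ)) • ∑ l ∈ Finset.range r, G x (z l)

/-- The pair `(c, H)` of a centre and a shape matrix of an ellipsoid. -/
abbrev EllipsoidData (n : ℕ) : Type :=
  EuclideanSpace ℝ (Fin n) × Matrix (Fin n) (Fin n) ℝ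

/-- The ellipsoid `{x | (x - c)ᵀ H⁻¹ (x - c) ≤ 1}`. -/
def ellipsoid {n : ℕ} (e : EllipsoidData n) : Set (EuclideanSpace ℝ (Fin n)) :=
  {x | (x - e.1).ofLp ⬝ᵥ (e.2⁻¹.mulVec (x - e.1).ofLp) ≤ 1}

/-- One update `(c, H) ↦ (c', H')` of the ellipsoid method along the direction `w`:
`c' = c - (1 / (n + 1)) H w / √(wᵀ H w)` and
`H' = (n² / (n² - 1)) (H - (2 / (n + 1)) H w wᵀ H / (wᵀ H w))`. -/
def ellipsoidUpdate {n : ℕ} (e : EllipsoidData n) (w : EuclideanSpace ℝ (Fin n)) :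
    EllipsoidData n :=
  let q : ℝ := w.ofLp ⬝ᵥ (e.2.mulVec w.ofLp)
  (e.1 - (1 / ((n : ℝ) + 1) / Real.sqrt q) • WithLp.toLp 2 (e.2.mulVec w.ofLp),
    ((n : ℝ) ^ 2 / ((n : ℝ) ^ 2 - 1)) •
      (e.2 - (2 / ((n : ℝ) + 1) / q) • (e.2 * Matrix.vecMulVec w.ofLp w.ofLp * e.2)))

/-- A separation oracle for `Q`: whenever the centre of an ellipsoid lies outside `Q`, it returns
a nonzero vector `w` such that the part of `Q` in the ellipsoid lies in the half-space
`⟨w, x - c⟩ ≤ 0`. -/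
structure IsSeparationOracle {n : ℕ} (Q : Set (EuclideanSpace ℝ (Fin n)))
    (sep : EllipsoidData n → EuclideanSpace ℝ (Fin n)) : Prop where
  measurable : Measurable fun p : EuclideanSpace ℝ (Fin n) × (Fin n → Fin n → ℝ) =>
    sep (p.1, Matrix.of p.2)
  ne_zero : ∀ e : EllipsoidData n, e.2.PosDef → e.1 ∉ Q → sep e ≠ 0
  separates : ∀ e : EllipsoidData n, e.2.PosDef → e.1 ∉ Q →
    ∀ x ∈ Q ∩ ellipsoid e, inner ℝ (sep e) (x - e.1) ≤ 0

open Classical in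
/-- The direction `w` used at the ellipsoid `e`: the answer of the (inexact) subgradient oracle
`g` if the centre is in `Q`, the answer of the separation oracle otherwise. -/
def direction {n : ℕ} (Q : Set (EuclideanSpace ℝ (Fin n)))
    (sep : EllipsoidData n → EuclideanSpace ℝ (Fin n))
    (g : EuclideanSpace ℝ (Fin n) → EuclideanSpace ℝ (Fin n)) (e : EllipsoidData n) :
    EuclideanSpace ℝ (Fin n) :=
  if e.1 ∈ Q then g e.1 else sep e

/-- The ellipsoids `(c_k, H_k)` of the method started from the ball with centre `c` and
radius `R`, where `g k` is the subgradient oracle of step `k`. -/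
def trajectory {n : ℕ} (Q : Set (EuclideanSpace ℝ (Fin n)))
    (sep : EllipsoidData n → EuclideanSpace ℝ (Fin n))
    (g : ℕ → EuclideanSpace ℝ (Fin n) → EuclideanSpace ℝ (Fin n))
    (c : EuclideanSpace ℝ (Fin n)) (R : ℝ) : ℕ → EllipsoidData n
  | 0 => (c, R ^ 2 • (1 : Matrix (Fin n) (Fin n) ℝ))
  | k + 1 => ellipsoidUpdate (trajectory Q sep g c R k)
      (direction Q sep (g k) (trajectory Q sep g c R k))

/-- The method stops at step `k`: `c_k ∈ Q` and the oracle answered `w_k = 0`. -/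
def StopsAt {n : ℕ} (Q : Set (EuclideanSpace ℝ (Fin n)))
    (sep : EllipsoidData n → EuclideanSpace ℝ (Fin n))
    (g : ℕ → EuclideanSpace ℝ (Fin n) → EuclideanSpace ℝ (Fin n))
    (c : EuclideanSpace ℝ (Fin n)) (R : ℝ) (k : ℕ) : Prop :=
  (trajectory Q sep g c R k).1 ∈ Q ∧ g k (trajectory Q sep g c R k).1 = 0

/-- The point `x` is a possible output of the ellipsoid method with `N` iterations: `x = c_k` for
the first step `k < N` at which the method stops or, if there is no such step, a minimizer of `f`
over `{c_0, …, c_N} ∩ Q`. (The values of `trajectory` after a stop are not used.) -/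
def IsOutput {n : ℕ} (Q : Set (EuclideanSpace ℝ (Fin n)))
    (f : EuclideanSpace ℝ (Fin n) → ℝ)
    (sep : EllipsoidData n → EuclideanSpace ℝ (Fin n))
    (g : ℕ → EuclideanSpace ℝ (Fin n) → EuclideanSpace ℝ (Fin n))
    (c : EuclideanSpace ℝ (Fin n)) (R : ℝ) (N : ℕ) (x : EuclideanSpace ℝ (Fin n)) : Prop :=
  (∃ k < N, StopsAt Q sep g c R k ∧ (∀ j < k, ¬ StopsAt Q sep g c R j) ∧
      x = (trajectory Q sep g c R k).1) ∨
  ((∀ k < N, ¬ StopsAt Q sep g c R k) ∧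
    x ∈ Q ∧ (∃ k ≤ N, x = (trajectory Q sep g c R k).1) ∧
    ∀ j ≤ N, (trajectory Q sep g c R j).1 ∈ Q → f x ≤ f (trajectory Q sep g c R j).1)

/-- The random point `xhat` of `Q` is an `(ε, β)`-solution of `min_{x ∈ Q} f(x)`. -/
def IsEpsBetaSolution {n : ℕ} {Ω : Type*} [MeasurableSpace Ω] (μ : Measure Ω)
    (Q : Set (EuclideanSpace ℝ (Fin n))) (f : EuclideanSpace ℝ (Fin n) → ℝ) (ε β : ℝ)
    (xhat : Ω → EuclideanSpace ℝ (Fin n)) : Prop :=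
  (∀ ω, xhat ω ∈ Q) ∧ μ {ω | f (xhat ω) - sInf (f '' Q) > ε} ≤ ENNReal.ofReal β

/-- The number of iterations `⌊2 n² ln (D B / (ρ ε))⌋`. -/
def iterations (n : ℕ) (D B ρ ε : ℝ) : ℕ :=
  ⌊2 * (n : ℝ) ^ 2 * Real.log (D * B / (ρ * ε))⌋₊

end StochEllipsoid

end

/-!
The ellipsoid method tolerates inexact subgradients: if every answer `w_k` at a centre `c_k ∈ Q` is
a `δ`-subgradient, then the output is within `α B + δ` of the minimum, where `α ρ` is any number
above the radius of a ball with the volume of the last ellipsoid (`IsOutput.le_add`). Indeed the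
copy of `Q` shrunk by `α` towards a minimizer does not fit into that ellipsoid (`exists_cut`), so
some point of the copy, at which `f` exceeds its minimum by at most `α B`, is cut off by a step with
`c_k ∈ Q`; being cut off means that `f (c_k)` exceeds the value there by at most `δ`. The same
volume argument with `α = 1` shows that a centre in `Q` is met at all, so that there is an output.

The volume decreases at least by the factor `exp (-1 / (2 n))` in each step (`det_factor_le`
bounds the square of this factor), which is sharp enough for `N = ⌊2 n² ln (D B / (ρ ε))⌋` steps to reach `α = 99 ε / (100 B)`: the rounding of `N`
costs at most `exp (1 / 8)`, and `√3 / 2 * exp (1 / 8) < 99 / 100`. This leaves `δ = ε / 100`,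
which is available as soon as the minibatch deviates from its mean, a subgradient, by at most
`ε / (100 D)`.

The deviation is controlled without any loss in the dimension. For independent centred light-tailed
vectors, `𝔼 cosh (t ‖S + X‖) ≤ exp (5 t² σ² / 4) 𝔼 cosh (t ‖S‖)`
(`lintegral_cosh_norm_add_le`), because `cosh ‖u + v‖` is at most
`cosh ‖u‖ (exp ‖v‖ - ‖v‖)` plus a term linear in `v` (`exists_cosh_norm_add_le`). The centre `c_k`
depends on earlier realizations only and is thus independent of the batch of step `k`, so that the
resulting tail bound applies at `c_k` by Fubini's theorem
(`measure_lt_norm_minibatch_trajectory_sub_le`); a union bound over the `N` steps concludes.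
-/

namespace StochEllipsoid

/-! ### The hyperbolic cosine of a norm -/

/-- The function `z ↦ cosh √z` is convex on `[0, ∞)`, because its power series `∑ z ^ k / (2 k)!`
has nonnegative coefficients. -/
lemma cosh_le_of_sq_eq_convexCombination {p q A B x : ℝ} (hp : 0 ≤ p) (hq : 0 ≤ q)
    (hpq : p + q = 1) (hx : x ^ 2 = p * A ^ 2 + q * B ^ 2) :
    Real.cosh x ≤ p * Real.cosh A + q * Real.cosh B := by
  refine hasSum_le (fun k => ?_) (Real.hasSum_cosh x)
    (((Real.hasSum_cosh A).mul_left p).add ((Real.hasSum_cosh B).mul_left q))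
  have h := (convexOn_pow k).2 (Set.mem_Ici.2 (sq_nonneg A)) (Set.mem_Ici.2 (sq_nonneg B))
    hp hq hpq
  simp only [smul_eq_mul] at h
  rw [pow_mul, pow_mul, pow_mul, hx, ← mul_div_assoc, ← mul_div_assoc, ← add_div]
  gcongr

lemma cosh_add_le (a : ℝ) {b : ℝ} (hb : 0 ≤ b) :
    Real.cosh (a + b) ≤ Real.cosh a * (Real.exp b - b) + Real.sinh a * b := by
  have h1 : b ≤ Real.sinh b := Real.self_le_sinh_iff.2 hb
  have h2 := (Real.sinh_lt_cosh a).le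
  rw [Real.cosh_add, ← Real.cosh_add_sinh b]
  nlinarith [mul_nonneg (sub_nonneg.2 h2) (sub_nonneg.2 h1)]

/-- A second order bound for `cosh ‖·‖` around `u`, uniform in the direction of `v`: its linear
term vanishes in the mean when `v` is a centred random vector. -/
lemma exists_cosh_norm_add_le {E : Type*} [NormedAddCommGroup E] [InnerProductSpace ℝ E] (u : E) :
    ∃ L : E, ∀ v : E, Real.cosh ‖u + v‖ ≤
      Real.cosh ‖u‖ * (Real.exp ‖v‖ - ‖v‖) + inner ℝ L v := by
  rcases eq_or_ne u 0 with rfl | hu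
  · refine ⟨0, fun v => ?_⟩
    simpa using cosh_add_le 0 (norm_nonneg v)
  have hu' : 0 < ‖u‖ := norm_pos_iff.2 hu
  refine ⟨(Real.sinh ‖u‖ / ‖u‖) • u, fun v => ?_⟩
  rcases eq_or_ne v 0 with rfl | hv
  · simp
  have hv' : 0 < ‖v‖ := norm_pos_iff.2 hv
  -- `c` is the cosine of the angle between `u` and `v`; the bound is linear in `c` on the right
  -- and convex in `c` on the left, so that it suffices to have it for `c = 1` and `c = -1`.
  obtain ⟨c, hc⟩ : ∃ c, c = inner ℝ u v / (‖u‖ * ‖v‖) := ⟨_, rfl⟩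
  have hin : inner ℝ u v = ‖u‖ * ‖v‖ * c := by rw [hc]; field_simp
  have habs := abs_le.1 (abs_real_inner_div_norm_mul_norm_le_one u v)
  rw [← hc] at habs
  have h1 := cosh_le_of_sq_eq_convexCombination (p := (1 + c) / 2) (q := (1 - c) / 2)
    (A := ‖u‖ + ‖v‖) (B := -‖u‖ + ‖v‖) (x := ‖u + v‖) (by linarith) (by linarith) (by ring)
    (by rw [norm_add_sq_real, hin]; ring)
  have h2 := cosh_add_le ‖u‖ hv'.le
  have h3 := cosh_add_le (-‖u‖) hv'.le
  rw [Real.cosh_neg, Real.sinh_neg] at h3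
  have h4 : inner ℝ ((Real.sinh ‖u‖ / ‖u‖) • u) v = Real.sinh ‖u‖ * ‖v‖ * c := by
    rw [real_inner_smul_left, hin]; field_simp
  rw [h4]
  nlinarith [mul_le_mul_of_nonneg_left h2 (show 0 ≤ (1 + c) / 2 by linarith),
    mul_le_mul_of_nonneg_left h3 (show 0 ≤ (1 - c) / 2 by linarith)]

/-! ### Concentration of sums of light-tailed vectors -/

lemma exp_le_self_add_exp_sq {x : ℝ} (hx : 0 ≤ x) : Real.exp x ≤ x + Real.exp (x ^ 2) := by
  rcases le_total x 1 with h | h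
  · have h1 := (abs_le.1 (Real.abs_exp_sub_one_sub_id_le (abs_le.2 ⟨by linarith, h⟩))).2
    linarith [Real.add_one_le_exp (x ^ 2)]
  · have : Real.exp x ≤ Real.exp (x ^ 2) := Real.exp_le_exp.2 (by nlinarith)
    linarith

/-- An affine bound for `exp x - x` in terms of `exp y`, where `x² = p y`. The bound `p ≤ 1` and
the bound `1 ≤ p` call for different coefficients `a`, `b`; both give the same estimate up to the
constant in the exponent when the mean of `exp y` is at most `e`. -/
lemma exists_affine_bound_exp_sub_self {p : ℝ} (hp : 0 ≤ p) :
    ∃ a b : ℝ, 0 ≤ a ∧ 0 ≤ b ∧ a + b * Real.exp 1 ≤ Real.exp (5 / 4 * p) ∧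
      ∀ x y : ℝ, 0 ≤ x → x ^ 2 = p * y → Real.exp x - x ≤ a + b * Real.exp y := by
  rcases le_total p 1 with h | h
  · refine ⟨Real.exp p * (1 - p), Real.exp p * (p * Real.exp (-1)), ?_, by positivity, ?_, ?_⟩
    · exact mul_nonneg (Real.exp_pos _).le (by linarith)
    · have h1 : Real.exp (-1) * Real.exp 1 = 1 := by rw [← Real.exp_add]; simp
      calc _ = Real.exp p * (1 - p + p * (Real.exp (-1) * Real.exp 1)) := by ring
        _ = Real.exp p := by rw [h1]; ring
        _ ≤ _ := Real.exp_le_exp.2 (by linarith)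
    · intro x y hx hxy
      have h1 := exp_le_self_add_exp_sq hx
      have h2 := convexOn_exp.2 (Set.mem_univ (y - 1)) (Set.mem_univ 0) hp (sub_nonneg.2 h)
        (by ring)
      simp only [smul_eq_mul, mul_zero, add_zero, Real.exp_zero, mul_one] at h2
      have h3 : Real.exp (x ^ 2) = Real.exp p * Real.exp (p * (y - 1)) := by
        rw [← Real.exp_add, hxy]; ring_nf
      have h4 : Real.exp (y - 1) = Real.exp (-1) * Real.exp y := by
        rw [← Real.exp_add]; ring_nf
      rw [h4] at h2
      nlinarith [mul_le_mul_of_nonneg_left h2 (Real.exp_pos p).le]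
  · refine ⟨0, Real.exp (p / 4), le_rfl, by positivity, ?_, ?_⟩
    · rw [zero_add, ← Real.exp_add]
      exact Real.exp_le_exp.2 (by linarith)
    · intro x y hx hxy
      have h1 : x ≤ p / 4 + y := by
        have hy : y = x ^ 2 / p := by rw [hxy]; field_simp
        have : p / 4 + y - x = (p / 2 - x) ^ 2 / p := by rw [hy]; field_simp; ring
        have h0 : 0 ≤ (p / 2 - x) ^ 2 / p := by positivity
        linarith
      have h2 : Real.exp x ≤ Real.exp (p / 4) * Real.exp y := by
        rw [← Real.exp_add]; exact Real.exp_le_exp.2 h1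
      linarith

section Concentration

variable {E : Type*} [NormedAddCommGroup E] [InnerProductSpace ℝ E] [CompleteSpace E]
  [MeasurableSpace E]

/-- Adding an independent centred light-tailed vector multiplies the mean of `cosh (t ‖·‖)` by at
most a Gaussian factor, which does not depend on the dimension. -/
lemma lintegral_cosh_norm_add_le {ν : Measure E} [IsProbabilityMeasure ν] {σ : ℝ} (hσ : 0 < σ)
    (hint : Integrable (fun x : E => x) ν) (hmean : ∫ x, x ∂ν = 0)
    (hexp : Integrable (fun x : E => Real.exp (‖x‖ ^ 2 / σ ^ 2)) ν)
    (hle : ∫ x, Real.exp (‖x‖ ^ 2 / σ ^ 2) ∂ν ≤ Real.exp 1) {t : ℝ} (ht : 0 ≤ t) (s : E) :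
    ∫⁻ x, ENNReal.ofReal (Real.cosh (t * ‖s + x‖)) ∂ν ≤
      ENNReal.ofReal (Real.exp (5 / 4 * (t ^ 2 * σ ^ 2))) *
        ENNReal.ofReal (Real.cosh (t * ‖s‖)) := by
  obtain ⟨a, b, ha, hb, hab, hbd⟩ :=
    exists_affine_bound_exp_sub_self (p := t ^ 2 * σ ^ 2) (by positivity)
  obtain ⟨L, hL⟩ := exists_cosh_norm_add_le (t • s)
  have hns : ∀ x : E, ‖t • x‖ = t * ‖x‖ := fun x => by
    rw [norm_smul, Real.norm_of_nonneg ht]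
  have hpt : ∀ x : E, Real.cosh (t * ‖s + x‖) ≤
      Real.cosh (t * ‖s‖) * (a + b * Real.exp (‖x‖ ^ 2 / σ ^ 2)) + t * inner ℝ L x := by
    intro x
    have h1 := hL (t • x)
    rw [← smul_add, hns, hns, hns, real_inner_smul_right] at h1
    have h2 := hbd (t * ‖x‖) (‖x‖ ^ 2 / σ ^ 2) (by positivity) (by field_simp)
    nlinarith [mul_le_mul_of_nonneg_left h2 (Real.cosh_pos (t * ‖s‖)).le]
  have hi1 : Integrable (fun x : E => a + b * Real.exp (‖x‖ ^ 2 / σ ^ 2)) ν :=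
    (integrable_const a).add (hexp.const_mul b)
  have hi2 : Integrable (fun x : E => t * inner ℝ L x) ν := (hint.const_inner L).const_mul t
  have hi : Integrable (fun x : E => Real.cosh (t * ‖s‖) *
      (a + b * Real.exp (‖x‖ ^ 2 / σ ^ 2)) + t * inner ℝ L x) ν := (hi1.const_mul _).add hi2
  calc ∫⁻ x, ENNReal.ofReal (Real.cosh (t * ‖s + x‖)) ∂ν
      ≤ ∫⁻ x, ENNReal.ofReal (Real.cosh (t * ‖s‖) *
          (a + b * Real.exp (‖x‖ ^ 2 / σ ^ 2)) + t * inner ℝ L x) ∂ν :=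
        lintegral_mono fun x => ENNReal.ofReal_le_ofReal (hpt x)
    _ = ENNReal.ofReal (∫ x, (Real.cosh (t * ‖s‖) *
          (a + b * Real.exp (‖x‖ ^ 2 / σ ^ 2)) + t * inner ℝ L x) ∂ν) :=
        (ofReal_integral_eq_lintegral_ofReal hi
          (Filter.Eventually.of_forall fun x => (Real.cosh_pos _).le.trans (hpt x))).symm
    _ ≤ _ := by
        rw [← ENNReal.ofReal_mul (Real.exp_pos _).le]
        refine ENNReal.ofReal_le_ofReal ?_
        rw [integral_add (hi1.const_mul _) hi2, integral_const_mul, integral_const_mul,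
          integral_inner hint, hmean, inner_zero_right, integral_add (integrable_const a)
          (hexp.const_mul b), integral_const_mul, mul_zero, add_zero, mul_comm]
        gcongr
        simp only [integral_const, probReal_univ, one_smul]
        nlinarith [mul_le_mul_of_nonneg_left hle hb]

variable [BorelSpace E] [SecondCountableTopology E]

/-- Sub-Gaussian bound for `cosh (t ‖·‖)` of a sum of independent centred light-tailed vectors. -/
lemma lintegral_cosh_norm_sum_le {Ω : Type*} [MeasurableSpace Ω] {μ : Measure Ω}
    [IsProbabilityMeasure μ] {X : ℕ → Ω → E} (hX : ∀ l, Measurable (X l)) (hind : iIndepFun X μ)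
    {σ : ℝ} (hσ : 0 < σ) (hint : ∀ l, Integrable (X l) μ) (hmean : ∀ l, ∫ ω, X l ω ∂μ = 0)
    (hexp : ∀ l, Integrable (fun ω => Real.exp (‖X l ω‖ ^ 2 / σ ^ 2)) μ)
    (hle : ∀ l, ∫ ω, Real.exp (‖X l ω‖ ^ 2 / σ ^ 2) ∂μ ≤ Real.exp 1)
    {t : ℝ} (ht : 0 ≤ t) (r : ℕ) :
    ∫⁻ ω, ENNReal.ofReal (Real.cosh (t * ‖∑ l ∈ Finset.range r, X l ω‖)) ∂μ ≤
      ENNReal.ofReal (Real.exp (5 / 4 * (t ^ 2 * σ ^ 2))) ^ r := by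
  induction r with
  | zero => simp
  | succ r ih =>
    have hS : Measurable (fun ω => ∑ l ∈ Finset.range r, X l ω) := by fun_prop
    have hindep : IndepFun (fun ω => ∑ l ∈ Finset.range r, X l ω) (X r) μ := by
      have := hind.indepFun_finsetSum_of_notMem hX (s := Finset.range r) (i := r) (by simp)
      rwa [show (∑ j ∈ Finset.range r, X j) = fun ω => ∑ l ∈ Finset.range r, X l ω from by
        ext ω; simp] at this
    have hmap := (indepFun_iff_map_prod_eq_prod_map_map hS.aemeasurable
      (hX r).aemeasurable).1 hindep
    have hφ : Measurable fun p : E × E => ENNReal.ofReal (Real.cosh (t * ‖p.1 + p.2‖)) := by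
      fun_prop
    have : IsProbabilityMeasure (μ.map (X r)) :=
      Measure.isProbabilityMeasure_map (hX r).aemeasurable
    have hexpm : Measurable fun x : E => Real.exp (‖x‖ ^ 2 / σ ^ 2) := by fun_prop
    calc ∫⁻ ω, ENNReal.ofReal (Real.cosh (t * ‖∑ l ∈ Finset.range (r + 1), X l ω‖)) ∂μ
        = ∫⁻ p, ENNReal.ofReal (Real.cosh (t * ‖p.1 + p.2‖))
            ∂(μ.map fun ω => (∑ l ∈ Finset.range r, X l ω, X r ω)) := by
          rw [lintegral_map hφ (hS.prodMk (hX r))]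
          simp only [Finset.sum_range_succ]
      _ = ∫⁻ s, ∫⁻ x, ENNReal.ofReal (Real.cosh (t * ‖s + x‖)) ∂(μ.map (X r))
            ∂(μ.map fun ω => ∑ l ∈ Finset.range r, X l ω) := by
          rw [hmap, lintegral_prod _ hφ.aemeasurable]
      _ ≤ ∫⁻ s, ENNReal.ofReal (Real.exp (5 / 4 * (t ^ 2 * σ ^ 2))) *
            ENNReal.ofReal (Real.cosh (t * ‖s‖))
            ∂(μ.map fun ω => ∑ l ∈ Finset.range r, X l ω) := by
          refine lintegral_mono fun s => lintegral_cosh_norm_add_le hσ ?_ ?_ ?_ ?_ ht s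
          · exact (integrable_map_measure (by fun_prop) (hX r).aemeasurable).2 (hint r)
          · rw [integral_map (hX r).aemeasurable (by fun_prop)]; exact hmean r
          · exact (integrable_map_measure hexpm.aestronglyMeasurable
              (hX r).aemeasurable).2 (hexp r)
          · rw [integral_map (hX r).aemeasurable hexpm.aestronglyMeasurable]; exact hle r
      _ ≤ _ := by
          rw [lintegral_const_mul _ (by fun_prop), lintegral_map (by fun_prop) hS, pow_succ' _ r]
          exact mul_le_mul_right ih _

/-- Dimension-free concentration of the average of independent centred light-tailed vectors. -/
lemma measure_lt_norm_average_le {Ω : Type*} [MeasurableSpace Ω] {μ : Measure Ω}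
    [IsProbabilityMeasure μ] {X : ℕ → Ω → E} (hX : ∀ l, Measurable (X l)) (hind : iIndepFun X μ)
    {σ : ℝ} (hσ : 0 < σ) (hint : ∀ l, Integrable (X l) μ) (hmean : ∀ l, ∫ ω, X l ω ∂μ = 0)
    (hexp : ∀ l, Integrable (fun ω => Real.exp (‖X l ω‖ ^ 2 / σ ^ 2)) μ)
    (hle : ∀ l, ∫ ω, Real.exp (‖X l ω‖ ^ 2 / σ ^ 2) ∂μ ≤ Real.exp 1)
    {τ : ℝ} (hτ : 0 < τ) {r : ℕ} (hr : 0 < r) :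
    μ {ω | τ < ‖(1 / (r : ℝ)) • ∑ l ∈ Finset.range r, X l ω‖} ≤
      ENNReal.ofReal (2 * Real.exp (-(r * τ ^ 2 / (5 * σ ^ 2)))) := by
  have hr' : (0 : ℝ) < r := by exact_mod_cast hr
  -- This `t` minimizes the exponent `5 / 4 * r * t² * σ² - t * r * τ` of the Chernoff bound.
  obtain ⟨t, ht⟩ : ∃ t, t = 2 * τ / (5 * σ ^ 2) := ⟨_, rfl⟩
  have ht0 : 0 < t := by rw [ht]; positivity
  have hmom := lintegral_cosh_norm_sum_le hX hind hσ hint hmean hexp hle ht0.le r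
  set φ : Ω → ENNReal := fun ω =>
    ENNReal.ofReal (Real.cosh (t * ‖∑ l ∈ Finset.range r, X l ω‖)) with hφ
  have hφm : Measurable φ := by fun_prop
  obtain ⟨K, hK⟩ : ∃ K, K = Real.exp (t * (r * τ)) / 2 := ⟨_, rfl⟩
  have hK0 : 0 < K := by rw [hK]; positivity
  have hsub : {ω | τ < ‖(1 / (r : ℝ)) • ∑ l ∈ Finset.range r, X l ω‖} ⊆
      {ω | ENNReal.ofReal K ≤ φ ω} := by
    intro ω hω
    simp only [Set.mem_ofPred_eq, norm_smul, norm_div, norm_one, Real.norm_natCast] at hω ⊢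
    refine ENNReal.ofReal_le_ofReal ?_
    have h1 : r * τ ≤ ‖∑ l ∈ Finset.range r, X l ω‖ := by
      rw [one_div, lt_inv_mul_iff₀ hr'] at hω
      exact hω.le
    rw [hK, Real.cosh_eq]
    have h2 : Real.exp (t * (r * τ)) ≤ Real.exp (t * ‖∑ l ∈ Finset.range r, X l ω‖) :=
      Real.exp_le_exp.2 (by gcongr)
    have := Real.exp_pos (-(t * ‖∑ l ∈ Finset.range r, X l ω‖))
    gcongr
    linarith
  have hmk := (mul_meas_ge_le_lintegral hφm (ENNReal.ofReal K)).trans hmom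
  rw [mul_comm, ← ENNReal.le_div_iff_mul_le (by simp [hK0]) (by simp)] at hmk
  refine (measure_mono hsub).trans (hmk.trans_eq ?_)
  rw [← ENNReal.ofReal_pow (Real.exp_pos _).le, ← ENNReal.ofReal_div_of_pos hK0, ← Real.exp_nat_mul,
    hK]
  congr 1
  rw [div_div_eq_mul_div, mul_comm _ (2 : ℝ), mul_div_assoc, ← Real.exp_sub]
  congr 2
  rw [ht]
  field_simp
  ring

/-- A light-tail bound around some point implies one around the mean, at the price of doubling the
parameter: the mean lies within `σ` of that point by Jensen's inequality. -/
lemma lightTail_around_mean {Ξ : Type*} [MeasurableSpace Ξ] {P : Measure Ξ}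
    [IsProbabilityMeasure P] {Y : Ξ → E} (hY : Measurable Y) {σ : ℝ} (hσ : 0 < σ) {g : E}
    (h : ∫⁻ z, ENNReal.ofReal (Real.exp (‖Y z - g‖ ^ 2 / σ ^ 2)) ∂P ≤
      ENNReal.ofReal (Real.exp 1)) :
    Integrable Y P ∧
      Integrable (fun z => Real.exp (‖Y z - ∫ z, Y z ∂P‖ ^ 2 / (2 * σ) ^ 2)) P ∧
      ∫ z, Real.exp (‖Y z - ∫ z, Y z ∂P‖ ^ 2 / (2 * σ) ^ 2) ∂P ≤ Real.exp 1 := by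
  have hm : Measurable fun z => Real.exp (‖Y z - g‖ ^ 2 / σ ^ 2) := by fun_prop
  have hi : Integrable (fun z => Real.exp (‖Y z - g‖ ^ 2 / σ ^ 2)) P := by
    refine ⟨hm.aestronglyMeasurable, ?_⟩
    rw [hasFiniteIntegral_iff_ofReal (Filter.Eventually.of_forall fun z => (Real.exp_pos _).le)]
    exact h.trans_lt ENNReal.ofReal_lt_top
  have hle : ∫ z, Real.exp (‖Y z - g‖ ^ 2 / σ ^ 2) ∂P ≤ Real.exp 1 := by
    rw [← ofReal_integral_eq_lintegral_ofReal hi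
      (Filter.Eventually.of_forall fun z => (Real.exp_pos _).le)] at h
    exact (ENNReal.ofReal_le_ofReal_iff (Real.exp_pos _).le).1 h
  have hsq : Integrable (fun z => ‖Y z - g‖ ^ 2 / σ ^ 2) P := by
    refine hi.mono' (by fun_prop) (Filter.Eventually.of_forall fun z => ?_)
    rw [Real.norm_of_nonneg (by positivity)]
    linarith [Real.add_one_le_exp (‖Y z - g‖ ^ 2 / σ ^ 2)]
  have hYg : Integrable (fun z => Y z - g) P := by
    refine ((hsq.const_mul (σ ^ 2)).add (integrable_const 1)).mono' (by fun_prop)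
      (Filter.Eventually.of_forall fun z => ?_)
    have : σ ^ 2 * (‖Y z - g‖ ^ 2 / σ ^ 2) = ‖Y z - g‖ ^ 2 := by field_simp
    simp only [Pi.add_apply, this]
    nlinarith [sq_nonneg (‖Y z - g‖ - 1)]
  have hYi : Integrable Y P := by
    refine (hYg.add (integrable_const g)).congr (Filter.Eventually.of_forall fun z => ?_)
    simp
  have hmean : ‖(∫ z, Y z ∂P) - g‖ ^ 2 ≤ σ ^ 2 := by
    have h1 : (∫ z, Y z ∂P) - g = ∫ z, (Y z - g) ∂P := by
      rw [integral_sub hYi (integrable_const g)]; simp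
    have h2 : ‖(∫ z, Y z ∂P) - g‖ ≤ ∫ z, ‖Y z - g‖ ∂P := by
      rw [h1]; exact norm_integral_le_integral_norm _
    -- The tangent of `exp` at `1` gives `𝔼 ‖Y - g‖² ≤ σ²`.
    have h3 : ∫ z, ‖Y z - g‖ ^ 2 / σ ^ 2 ∂P ≤ 1 := by
      have h4 : ∫ z, (Real.exp 1 * (‖Y z - g‖ ^ 2 / σ ^ 2)) ∂P ≤ Real.exp 1 := by
        refine (integral_mono (hsq.const_mul _) hi fun z => ?_).trans hle
        have h5 := Real.add_one_le_exp (‖Y z - g‖ ^ 2 / σ ^ 2 - 1)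
        have h6 := mul_le_mul_of_nonneg_left h5 (Real.exp_pos 1).le
        rw [← Real.exp_add] at h6
        simpa using h6
      rw [integral_const_mul] at h4
      have := Real.exp_pos 1
      nlinarith
    have h7 : ∫ z, ‖Y z - g‖ ∂P ≤ σ := by
      have h8 : ∫ z, ‖Y z - g‖ ∂P ≤ ∫ z, (σ / 2 * (‖Y z - g‖ ^ 2 / σ ^ 2) + σ / 2) ∂P := by
        refine integral_mono hYg.norm ((hsq.const_mul _).add (integrable_const _)) fun z => ?_
        have : σ / 2 * (‖Y z - g‖ ^ 2 / σ ^ 2) + σ / 2 - ‖Y z - g‖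
            = (‖Y z - g‖ - σ) ^ 2 / (2 * σ) := by field_simp; ring
        have h9 : 0 ≤ (‖Y z - g‖ - σ) ^ 2 / (2 * σ) := by positivity
        simp only
        linarith
      rw [integral_add (hsq.const_mul _) (integrable_const _), integral_const_mul] at h8
      simp only [integral_const, probReal_univ, one_smul] at h8
      nlinarith
    have := norm_nonneg ((∫ z, Y z ∂P) - g)
    nlinarith
  have hpt : ∀ z, Real.exp (‖Y z - ∫ z, Y z ∂P‖ ^ 2 / (2 * σ) ^ 2) ≤
      (1 / 2) * Real.exp (‖Y z - g‖ ^ 2 / σ ^ 2) + (1 / 2) * Real.exp 1 := by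
    intro z
    have h1 : ‖Y z - ∫ z, Y z ∂P‖ ≤ ‖Y z - g‖ + ‖(∫ z, Y z ∂P) - g‖ := by
      have := norm_sub_le (Y z - g) ((∫ z, Y z ∂P) - g)
      rwa [sub_sub_sub_cancel_right] at this
    have h2 : ‖Y z - ∫ z, Y z ∂P‖ ^ 2 / (2 * σ) ^ 2 ≤
        (1 / 2) * (‖Y z - g‖ ^ 2 / σ ^ 2) + (1 / 2) * 1 := by
      have h3 : ‖Y z - ∫ z, Y z ∂P‖ ^ 2 ≤ 2 * ‖Y z - g‖ ^ 2 + 2 * σ ^ 2 := by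
        have h4 := pow_le_pow_left₀ (norm_nonneg _) h1 2
        nlinarith [sq_nonneg (‖Y z - g‖ - ‖(∫ z, Y z ∂P) - g‖)]
      rw [div_le_iff₀ (by positivity)]
      have : ((1 / 2) * (‖Y z - g‖ ^ 2 / σ ^ 2) + (1 / 2) * 1) * (2 * σ) ^ 2
        = 2 * ‖Y z - g‖ ^ 2 + 2 * σ ^ 2 := by field_simp
      rwa [this]
    refine (Real.exp_le_exp.2 h2).trans ?_
    exact convexOn_exp.2 (Set.mem_univ _) (Set.mem_univ _) (by norm_num) (by norm_num)
      (by norm_num)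
  have hib := (hi.const_mul (1 / 2)).add (integrable_const (μ := P) ((1 / 2) * Real.exp 1))
  have hie : Integrable (fun z => Real.exp (‖Y z - ∫ z, Y z ∂P‖ ^ 2 / (2 * σ) ^ 2)) P := by
    refine hib.mono' (by fun_prop) (Filter.Eventually.of_forall fun z => ?_)
    rw [Real.norm_of_nonneg (Real.exp_pos _).le]
    exact hpt z
  refine ⟨hYi, hie, (integral_mono hie hib hpt).trans ?_⟩
  simp only [Pi.add_apply]
  rw [integral_add (hi.const_mul _) (integrable_const _), integral_const_mul]
  simp only [integral_const, probReal_univ, one_smul]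
  linarith

end Concentration

/-! ### One step of the ellipsoid method -/

/-- The Sherman–Morrison formula for the shape matrix of the updated ellipsoid. -/
lemma ellipsoidUpdate_snd_inv {n : ℕ} (hn : 2 ≤ n) {e : EllipsoidData n} (he : e.2.PosDef)
    {w : EuclideanSpace ℝ (Fin n)} (hw : w ≠ 0) :
    (ellipsoidUpdate e w).2⁻¹ = (((n : ℝ) ^ 2 - 1) / (n : ℝ) ^ 2) •
      (e.2⁻¹ + (2 / ((n : ℝ) - 1) / (w.ofLp ⬝ᵥ (e.2.mulVec w.ofLp))) •
        Matrix.vecMulVec w.ofLp w.ofLp) ∧ IsUnit (ellipsoidUpdate e w).2.det := by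
  have hw' : w.ofLp ≠ 0 := by simpa using hw
  have hq : 0 < w.ofLp ⬝ᵥ (e.2.mulVec w.ofLp) := he.dotProduct_mulVec_pos hw'
  have hn' : (2 : ℝ) ≤ n := by exact_mod_cast hn
  have hdet : IsUnit e.2.det := he.isUnit.map Matrix.detMonoidHom
  have hmul : (ellipsoidUpdate e w).2 * ((((n : ℝ) ^ 2 - 1) / (n : ℝ) ^ 2) •
      (e.2⁻¹ + (2 / ((n : ℝ) - 1) / (w.ofLp ⬝ᵥ (e.2.mulVec w.ofLp))) •
        Matrix.vecMulVec w.ofLp w.ofLp)) = 1 := by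
    simp only [ellipsoidUpdate]
    obtain ⟨q, hqd⟩ : ∃ q, q = w.ofLp ⬝ᵥ (e.2.mulVec w.ofLp) := ⟨_, rfl⟩
    rw [← hqd] at hq ⊢
    have hwHw : Matrix.vecMulVec w.ofLp w.ofLp * (e.2 * Matrix.vecMulVec w.ofLp w.ofLp)
        = q • Matrix.vecMulVec w.ofLp w.ofLp := by
      rw [Matrix.mul_vecMulVec, Matrix.vecMulVec_mul_vecMulVec, ← hqd, Matrix.vecMulVec_smul]
    have hHH : e.2 * e.2⁻¹ = 1 := Matrix.mul_nonsing_inv _ hdet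
    rw [Matrix.smul_mul, Matrix.mul_smul, smul_smul, mul_add, sub_mul, sub_mul, hHH,
      Matrix.smul_mul, Matrix.mul_assoc (e.2 * _), hHH, Matrix.mul_one, Matrix.smul_mul,
      Matrix.mul_smul, Matrix.mul_smul, Matrix.mul_assoc (e.2 * _),
      Matrix.mul_assoc e.2 (Matrix.vecMulVec _ _), hwHw, Matrix.mul_smul]
    generalize e.2 * Matrix.vecMulVec w.ofLp w.ofLp = M
    have h1 : (n : ℝ) - 1 ≠ 0 := by linarith
    have h2 : (n : ℝ) + 1 ≠ 0 := by linarith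
    have h3 : (n : ℝ) ^ 2 - 1 ≠ 0 := by nlinarith
    have h4 : (n : ℝ) ≠ 0 := by linarith
    ext i j
    simp only [Matrix.smul_apply, Matrix.add_apply, Matrix.sub_apply, smul_eq_mul]
    field_simp
    ring
  refine ⟨Matrix.inv_eq_right_inv hmul, ?_⟩
  exact IsUnit.of_mul_eq_one _ (by rw [← Matrix.det_mul, hmul, Matrix.det_one])

lemma ellipsoidUpdate_posDef {n : ℕ} (hn : 2 ≤ n) {e : EllipsoidData n} (he : e.2.PosDef)
    {w : EuclideanSpace ℝ (Fin n)} (hw : w ≠ 0) : (ellipsoidUpdate e w).2.PosDef := by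
  have hw' : w.ofLp ≠ 0 := by simpa using hw
  have hq : 0 < w.ofLp ⬝ᵥ (e.2.mulVec w.ofLp) := he.dotProduct_mulVec_pos hw'
  have hn' : (2 : ℝ) ≤ n := by exact_mod_cast hn
  obtain ⟨hinv, hunit⟩ := ellipsoidUpdate_snd_inv hn he hw
  have h1 : (ellipsoidUpdate e w).2⁻¹.PosDef := by
    rw [hinv]
    refine Matrix.PosDef.smul (he.inv.add_posSemidef (Matrix.PosSemidef.smul ?_ ?_)) ?_
    · simpa using Matrix.posSemidef_vecMulVec_self_star (R := ℝ) w.ofLp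
    · exact div_nonneg (div_nonneg zero_le_two (by linarith)) hq.le
    · exact div_pos (by nlinarith) (by positivity)
  have h2 := h1.inv
  rwa [Matrix.nonsing_inv_nonsing_inv _ hunit] at h2

lemma ellipsoidUpdate_det {n : ℕ} (hn : 2 ≤ n) {e : EllipsoidData n} (he : e.2.PosDef)
    {w : EuclideanSpace ℝ (Fin n)} (hw : w ≠ 0) :
    (ellipsoidUpdate e w).2.det =
      ((n : ℝ) ^ 2 / ((n : ℝ) ^ 2 - 1)) ^ n * (((n : ℝ) - 1) / (n + 1)) * e.2.det := by
  have hw' : w.ofLp ≠ 0 := by simpa using hw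
  have hq : 0 < w.ofLp ⬝ᵥ (e.2.mulVec w.ofLp) := he.dotProduct_mulVec_pos hw'
  simp only [ellipsoidUpdate]
  obtain ⟨q, hqd⟩ : ∃ q, q = w.ofLp ⬝ᵥ (e.2.mulVec w.ofLp) := ⟨_, rfl⟩
  rw [← hqd] at hq ⊢
  have hfac : e.2 - (2 / ((n : ℝ) + 1) / q) • (e.2 * Matrix.vecMulVec w.ofLp w.ofLp * e.2)
      = (1 + Matrix.replicateCol Unit (-(2 / ((n : ℝ) + 1) / q) • (e.2.mulVec w.ofLp)) *
          Matrix.replicateRow Unit w.ofLp) * e.2 := by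
    rw [← Matrix.vecMulVec_eq, Matrix.smul_vecMulVec, ← Matrix.mul_vecMulVec, add_mul, one_mul,
      Matrix.smul_mul, neg_smul, sub_eq_add_neg]
  rw [Matrix.det_smul, hfac, Matrix.det_mul, Matrix.det_one_add_replicateCol_mul_replicateRow,
    dotProduct_smul, ← hqd, Fintype.card_fin, smul_eq_mul]
  have h2 : (n : ℝ) + 1 ≠ 0 := by positivity
  rw [mul_assoc]
  congr 2
  field_simp
  ring

lemma mem_ellipsoidUpdate {n : ℕ} (hn : 2 ≤ n) {e : EllipsoidData n} (he : e.2.PosDef)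
    {w : EuclideanSpace ℝ (Fin n)} (hw : w ≠ 0) {x : EuclideanSpace ℝ (Fin n)}
    (hx : x ∈ ellipsoid e) (hwx : inner ℝ w (x - e.1) ≤ 0) :
    x ∈ ellipsoid (ellipsoidUpdate e w) := by
  have hw' : w.ofLp ≠ 0 := by simpa using hw
  have hq : 0 < w.ofLp ⬝ᵥ (e.2.mulVec w.ofLp) := he.dotProduct_mulVec_pos hw'
  have hn' : (2 : ℝ) ≤ n := by exact_mod_cast hn
  have hdet : IsUnit e.2.det := he.isUnit.map Matrix.detMonoidHom
  have hx' : (x - e.1).ofLp ⬝ᵥ (e.2⁻¹.mulVec (x - e.1).ofLp) ≤ 1 := hx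
  change (x - (ellipsoidUpdate e w).1).ofLp ⬝ᵥ
    ((ellipsoidUpdate e w).2⁻¹.mulVec (x - (ellipsoidUpdate e w).1).ofLp) ≤ 1
  rw [(ellipsoidUpdate_snd_inv hn he hw).1]
  have hwx' : w.ofLp ⬝ᵥ (x - e.1).ofLp ≤ 0 := by
    rwa [EuclideanSpace.inner_eq_star_dotProduct, star_trivial, dotProduct_comm] at hwx
  have hy' : (x - (ellipsoidUpdate e w).1).ofLp = (x - e.1).ofLp +
      (1 / ((n : ℝ) + 1) / √(w.ofLp ⬝ᵥ (e.2.mulVec w.ofLp))) • e.2.mulVec w.ofLp := by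
    simp only [ellipsoidUpdate, WithLp.ofLp_sub, WithLp.ofLp_smul]
    abel
  rw [hy']
  generalize (x - e.1).ofLp = y at *
  generalize w.ofLp = v at *
  obtain ⟨q, hqd⟩ : ∃ q, q = v ⬝ᵥ (e.2.mulVec v) := ⟨_, rfl⟩
  rw [← hqd] at hq ⊢
  obtain ⟨s, hs⟩ : ∃ s, s = √q := ⟨_, rfl⟩
  have hs0 : 0 < s := by rw [hs]; exact Real.sqrt_pos.2 hq
  have hsq : q = s ^ 2 := by rw [hs, Real.sq_sqrt hq.le]
  rw [← hs]
  have hsymm : ∀ a b : Fin n → ℝ, a ⬝ᵥ (e.2⁻¹.mulVec b) = b ⬝ᵥ (e.2⁻¹.mulVec a) := by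
    intro a b
    have hT : (e.2⁻¹).transpose = e.2⁻¹ := by
      have := he.inv.isHermitian
      rwa [Matrix.IsHermitian, Matrix.conjTranspose_eq_transpose_of_trivial] at this
    rw [dotProduct_comm, ← Matrix.vecMul_transpose, hT, ← Matrix.dotProduct_mulVec]
  have hHv : e.2⁻¹.mulVec (e.2.mulVec v) = v := by
    rw [Matrix.mulVec_mulVec, Matrix.nonsing_inv_mul _ hdet, Matrix.one_mulVec]
  have hquad : ∀ t : ℝ, (y + t • e.2.mulVec v) ⬝ᵥ (e.2⁻¹.mulVec (y + t • e.2.mulVec v)) =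
      y ⬝ᵥ (e.2⁻¹.mulVec y) + 2 * t * (v ⬝ᵥ y) + t ^ 2 * q := by
    intro t
    rw [Matrix.mulVec_add, Matrix.mulVec_smul, hHv, add_dotProduct, dotProduct_add,
      dotProduct_add, smul_dotProduct, smul_dotProduct, dotProduct_smul, dotProduct_smul,
      hsymm (e.2.mulVec v) y, hHv, dotProduct_comm (e.2.mulVec v) v, ← hqd, dotProduct_comm y v]
    simp only [smul_eq_mul]
    ring
  have hlin : ∀ t : ℝ, v ⬝ᵥ (y + t • e.2.mulVec v) = v ⬝ᵥ y + t * q := by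
    intro t
    rw [dotProduct_add, dotProduct_smul, ← hqd, smul_eq_mul]
  -- In the coordinate `a` along `w`, the half ellipsoid lies in the slab `-1 ≤ a ≤ 0`.
  obtain ⟨a, ha⟩ : ∃ a, a = (v ⬝ᵥ y) / s := ⟨_, rfl⟩
  have hvy : v ⬝ᵥ y = a * s := by rw [ha]; field_simp
  have ha0 : a ≤ 0 := by rw [ha]; exact div_nonpos_of_nonpos_of_nonneg hwx' hs0.le
  have ha1 : -1 ≤ a := by
    have h0 := he.inv.posSemidef.dotProduct_mulVec_nonneg (y + (1 / s) • e.2.mulVec v)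
    rw [star_trivial, hquad, hvy, hsq] at h0
    have : 2 * (1 / s) * (a * s) + (1 / s) ^ 2 * s ^ 2 = 2 * a + 1 := by field_simp
    linarith
  rw [Matrix.smul_mulVec, Matrix.add_mulVec, Matrix.smul_mulVec, Matrix.vecMulVec_mulVec,
    dotProduct_smul, dotProduct_add, dotProduct_smul, hquad, dotProduct_smul]
  simp only [op_smul_eq_mul, smul_eq_mul]
  rw [dotProduct_comm _ v, hlin, hvy, hsq]
  obtain ⟨b, hb⟩ : ∃ b, b = y ⬝ᵥ (e.2⁻¹.mulVec y) := ⟨_, rfl⟩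
  rw [← hb] at hx' ⊢
  have h1 : (0 : ℝ) < n - 1 := by linarith
  have hn2 : (0 : ℝ) < (n : ℝ) ^ 2 - 1 := by nlinarith
  have key : ((n : ℝ) ^ 2 - 1) / (n : ℝ) ^ 2 * (b + 2 * (1 / ((n : ℝ) + 1) / s) * (a * s) +
      (1 / ((n : ℝ) + 1) / s) ^ 2 * s ^ 2 + 2 / ((n : ℝ) - 1) / s ^ 2 *
        ((a * s + 1 / ((n : ℝ) + 1) / s * s ^ 2) * (a * s + 1 / ((n : ℝ) + 1) / s * s ^ 2)))
      = 1 - ((n : ℝ) ^ 2 - 1) / (n : ℝ) ^ 2 * (1 - b) +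
        ((n : ℝ) ^ 2 - 1) / (n : ℝ) ^ 2 * (2 / ((n : ℝ) - 1)) * (a * (a + 1)) := by
    have := hn2.ne'
    have := h1.ne'
    field_simp
    ring
  rw [key]
  have hc : 0 ≤ ((n : ℝ) ^ 2 - 1) / (n : ℝ) ^ 2 := by positivity
  have h5 : 0 ≤ ((n : ℝ) ^ 2 - 1) / (n : ℝ) ^ 2 * (1 - b) := mul_nonneg hc (by linarith)
  have h6 : ((n : ℝ) ^ 2 - 1) / (n : ℝ) ^ 2 * (2 / ((n : ℝ) - 1)) * (a * (a + 1)) ≤ 0 :=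
    mul_nonpos_of_nonneg_of_nonpos (by positivity)
      (mul_nonpos_of_nonpos_of_nonneg ha0 (by linarith))
  linarith

/-! ### Volumes -/

lemma volume_ellipsoid {n : ℕ} {e : EllipsoidData n} (he : e.2.PosDef) :
    volume (ellipsoid e) = ENNReal.ofReal (√e.2.det) *
      volume (Metric.ball (0 : EuclideanSpace ℝ (Fin n)) 1) := by
  -- Writing `H⁻¹ = AᵀA`, the ellipsoid is the preimage of the unit ball under `x ↦ A (x - c)`.
  obtain ⟨A, hA, hAA⟩ : ∃ A : Matrix (Fin n) (Fin n) ℝ, A.det ≠ 0 ∧ e.2⁻¹ = A.transpose * A := by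
    open scoped MatrixOrder in
    obtain ⟨A, hA⟩ := CStarAlgebra.nonneg_iff_eq_star_mul_self.mp he.inv.posSemidef.nonneg
    rw [Matrix.star_eq_conjTranspose, Matrix.conjTranspose_eq_transpose_of_trivial] at hA
    refine ⟨A, fun h0 => ?_, hA⟩
    have := he.inv.det_pos
    rw [hA, Matrix.det_mul, h0, mul_zero] at this
    exact this.false
  have hdet : LinearMap.det (Matrix.toEuclideanLin A) = A.det := by
    rw [Matrix.toEuclideanLin_eq_toLin_orthonormal, LinearMap.det_toLin]
  have hset : ellipsoid e = (fun x => x + -e.1) ⁻¹'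
      (Matrix.toEuclideanLin A ⁻¹' Metric.closedBall 0 1) := by
    ext x
    simp only [← sub_eq_add_neg, ellipsoid, Set.mem_ofPred_eq, Set.mem_preimage, mem_closedBall_zero_iff]
    rw [← sq_le_one_iff₀ (norm_nonneg _), ← real_inner_self_eq_norm_sq,
      EuclideanSpace.inner_eq_star_dotProduct, star_trivial, Matrix.ofLp_toLpLin,
      Matrix.toLin'_apply, hAA,
      ← Matrix.mulVec_mulVec, Matrix.dotProduct_mulVec, Matrix.vecMul_transpose]
  have hdetA : |A.det⁻¹| = √e.2.det := by
    have h1 : e.2.det = (A.det⁻¹) ^ 2 := by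
      have h2 : e.2.det⁻¹ = A.det ^ 2 := by
        rw [← Ring.inverse_eq_inv', ← Matrix.det_nonsing_inv, hAA, Matrix.det_mul, Matrix.det_transpose, sq]
      rw [inv_pow, ← h2, inv_inv]
    rw [h1, Real.sqrt_sq_eq_abs]
  rw [hset, measure_preimage_add_right, Measure.addHaar_preimage_linearMap _ (by rwa [hdet]), hdet,
    hdetA, Measure.addHaar_closedBall _ _ zero_le_one, one_pow, ENNReal.ofReal_one, one_mul]

/-- The decrease of the determinant in one step. With `x = 1 / n`, the logarithm of the left side
is `∑ (1 / (k + 1) - 2 / (2 k + 1)) x ^ (2 k + 1)`, whose first term is `-x` and whose other terms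
are nonpositive. -/
lemma det_factor_le {n : ℕ} (hn : 2 ≤ n) :
    ((n : ℝ) ^ 2 / ((n : ℝ) ^ 2 - 1)) ^ n * (((n : ℝ) - 1) / (n + 1)) ≤
      Real.exp (-(1 / (n : ℝ))) := by
  have hn' : (2 : ℝ) ≤ n := by exact_mod_cast hn
  obtain ⟨x, hx⟩ : ∃ x : ℝ, x = 1 / n := ⟨_, rfl⟩
  have hx0 : 0 < x := by rw [hx]; positivity
  have hx1 : x < 1 := by rw [hx, div_lt_one (by positivity)]; linarith
  have hxn : (n : ℝ) * x = 1 := by rw [hx]; field_simp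
  have s1 := Real.hasSum_log_sub_log_of_abs_lt_one (x := x) (by rw [abs_of_pos hx0]; exact hx1)
  have s2 := (Real.hasSum_pow_div_log_of_abs_lt_one (x := x ^ 2)
    (by rw [abs_of_pos (by positivity)]; nlinarith)).mul_left (n : ℝ)
  have s3 : HasSum (fun k : ℕ => if k = 0 then -x else 0) (-x) := hasSum_ite_eq 0 (-x)
  have hmain := hasSum_le (fun k : ℕ => ?_) (s2.sub s1) s3
  · have h1 : (0 : ℝ) < 1 - x := by linarith
    have h2 : (0 : ℝ) < 1 + x := by linarith
    have h3 : (0 : ℝ) < 1 - x ^ 2 := by nlinarith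
    have e1 : (n : ℝ) ^ 2 / ((n : ℝ) ^ 2 - 1) = (1 - x ^ 2)⁻¹ := by
      have : (n : ℝ) ^ 2 - 1 ≠ 0 := by nlinarith
      have h3' := h3.ne'
      rw [hx] at h3' ⊢
      field_simp
    have e2 : ((n : ℝ) - 1) / (n + 1) = (1 - x) / (1 + x) := by
      have h2' := h2.ne'
      rw [hx] at h2' ⊢
      field_simp
    rw [e1, e2, ← hx, ← Real.log_le_iff_le_exp (by positivity), Real.log_mul (by positivity)
      (by positivity), Real.log_pow, Real.log_inv, Real.log_div h1.ne' h2.ne']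
    linarith
  · have hpow : (n : ℝ) * ((x ^ 2) ^ (k + 1) / (k + 1)) = x ^ (2 * k + 1) / (k + 1) := by
      have : (x ^ 2) ^ (k + 1) = x * x ^ (2 * k + 1) := by rw [← pow_mul]; ring
      rw [this, ← mul_div_assoc, ← mul_assoc, hxn, one_mul]
    rw [hpow]
    split_ifs with hk
    · subst hk
      norm_num
      linarith
    · have hp : 0 < x ^ (2 * k + 1) := by positivity
      have : x ^ (2 * k + 1) / (k + 1) - 2 * (1 / (2 * (k : ℝ) + 1)) * x ^ (2 * k + 1)
          = -(x ^ (2 * k + 1) / ((k + 1) * (2 * k + 1))) := by field_simp; ring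
      rw [this]
      exact neg_nonpos.2 (by positivity)

/-! ### The run of the method before it stops -/

lemma ellipsoid_ball {n : ℕ} {c : EuclideanSpace ℝ (Fin n)} {R : ℝ} (hR : 0 < R) :
    ellipsoid (c, R ^ 2 • (1 : Matrix (Fin n) (Fin n) ℝ)) = Metric.closedBall c R := by
  ext x
  have hinv : (R ^ 2 • (1 : Matrix (Fin n) (Fin n) ℝ))⁻¹ = (R ^ 2)⁻¹ • 1 :=
    Matrix.inv_eq_right_inv (by
      rw [Matrix.smul_mul, Matrix.mul_smul, smul_smul, Matrix.one_mul,
        mul_inv_cancel₀ (by positivity), one_smul])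
  change (x - c).ofLp ⬝ᵥ ((R ^ 2 • (1 : Matrix (Fin n) (Fin n) ℝ))⁻¹.mulVec (x - c).ofLp) ≤ 1 ↔ _
  rw [hinv, Matrix.smul_mulVec, Matrix.one_mulVec, dotProduct_smul, smul_eq_mul,
    Metric.mem_closedBall, dist_eq_norm]
  have h1 : (x - c).ofLp ⬝ᵥ (x - c).ofLp = ‖x - c‖ ^ 2 := by
    rw [← real_inner_self_eq_norm_sq, EuclideanSpace.inner_eq_star_dotProduct, star_trivial]
  rw [h1, inv_mul_le_iff₀ (by positivity), mul_one, sq_le_sq₀ (norm_nonneg _) hR.le]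

section Trajectory

variable {n : ℕ} {Q : Set (EuclideanSpace ℝ (Fin n))}
  {sep : EllipsoidData n → EuclideanSpace ℝ (Fin n)}
  {g : ℕ → EuclideanSpace ℝ (Fin n) → EuclideanSpace ℝ (Fin n)}
  {c : EuclideanSpace ℝ (Fin n)} {R : ℝ} {N : ℕ}

lemma direction_ne_zero (hsep : IsSeparationOracle Q sep) {k : ℕ}
    (hpos : (trajectory Q sep g c R k).2.PosDef) (hk : ¬ StopsAt Q sep g c R k) :
    direction Q sep (g k) (trajectory Q sep g c R k) ≠ 0 := by
  unfold direction
  split_ifs with h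
  · exact fun h0 => hk ⟨h, h0⟩
  · exact hsep.ne_zero _ hpos h

lemma trajectory_posDef (hn : 2 ≤ n) (hR : 0 < R) (hsep : IsSeparationOracle Q sep)
    (hrun : ∀ k < N, ¬ StopsAt Q sep g c R k) {k : ℕ} (hk : k ≤ N) :
    (trajectory Q sep g c R k).2.PosDef := by
  induction k with
  | zero => exact Matrix.PosDef.one.smul (by positivity)
  | succ k ih =>
    have hpos := ih (by omega)
    exact ellipsoidUpdate_posDef hn hpos (direction_ne_zero hsep hpos (hrun k (by omega)))

lemma trajectory_det_le (hn : 2 ≤ n) (hR : 0 < R) (hsep : IsSeparationOracle Q sep)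
    (hrun : ∀ k < N, ¬ StopsAt Q sep g c R k) {k : ℕ} (hk : k ≤ N) :
    (trajectory Q sep g c R k).2.det ≤ (R * Real.exp (-(k / (2 * (n : ℝ) ^ 2)))) ^ (2 * n) := by
  have hn' : (0 : ℝ) < n := by exact_mod_cast (by omega : 0 < n)
  induction k with
  | zero =>
    simp only [trajectory, Matrix.det_smul, Matrix.det_one, Fintype.card_fin]
    simp [pow_mul]
  | succ k ih =>
    have hpos := trajectory_posDef hn hR hsep hrun (k := k) (by omega)
    have hw := direction_ne_zero hsep hpos (hrun k (by omega))
    simp only [trajectory]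
    rw [ellipsoidUpdate_det hn hpos hw]
    have hexp : (R * Real.exp (-((k + 1 : ℕ) / (2 * (n : ℝ) ^ 2)))) ^ (2 * n) =
        Real.exp (-(1 / (n : ℝ))) * (R * Real.exp (-(k / (2 * (n : ℝ) ^ 2)))) ^ (2 * n) := by
      rw [mul_pow, mul_pow, ← Real.exp_nat_mul, ← Real.exp_nat_mul, mul_left_comm, ← Real.exp_add]
      congr 2
      push_cast
      field_simp
      ring
    rw [hexp]
    exact mul_le_mul (det_factor_le hn) (ih (by omega)) hpos.det_pos.le (Real.exp_pos _).le

/-- A point of `Q` that has left the ellipsoid was cut off by a subgradient step, since the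
separating steps do not remove any point of `Q`. -/
lemma exists_cut_of_notMem_ellipsoid (hn : 2 ≤ n) (hR : 0 < R) (hQ : Q ⊆ Metric.closedBall c R)
    (hsep : IsSeparationOracle Q sep) (hrun : ∀ k < N, ¬ StopsAt Q sep g c R k)
    {x : EuclideanSpace ℝ (Fin n)} (hx : x ∈ Q)
    (hxN : x ∉ ellipsoid (trajectory Q sep g c R N)) :
    ∃ k < N, (trajectory Q sep g c R k).1 ∈ Q ∧
      0 < inner ℝ (g k (trajectory Q sep g c R k).1) (x - (trajectory Q sep g c R k).1) := by
  by_contra! hcon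
  have hmem : ∀ k ≤ N, x ∈ ellipsoid (trajectory Q sep g c R k) := by
    intro k hk
    induction k with
    | zero =>
      rw [trajectory, ellipsoid_ball hR]
      exact hQ hx
    | succ k ih =>
      have hxk := ih (by omega)
      have hpos := trajectory_posDef hn hR hsep hrun (k := k) (by omega)
      refine mem_ellipsoidUpdate hn hpos (direction_ne_zero hsep hpos (hrun k (by omega))) hxk ?_
      unfold direction
      split_ifs with h
      · exact hcon k (by omega) h
      · exact hsep.separates _ hpos h x ⟨hx, hxk⟩
  exact hxN (hmem N le_rfl)

/-- The copy of `Q` shrunk by the factor `α` towards a point `z` of `Q` is too large for the last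
ellipsoid, so that one of its points has been cut off by a subgradient step. -/
lemma exists_cut (hn : 2 ≤ n) (hR : 0 < R) (hQ : Q ⊆ Metric.closedBall c R) (hconv : Convex ℝ Q)
    (hsep : IsSeparationOracle Q sep) (hrun : ∀ k < N, ¬ StopsAt Q sep g c R k)
    {x₀ : EuclideanSpace ℝ (Fin n)} {ρ : ℝ} (hρ : 0 < ρ) (hball : Metric.closedBall x₀ ρ ⊆ Q)
    {α : ℝ} (hα0 : 0 < α) (hα1 : α ≤ 1) (hlt : R * Real.exp (-(N / (2 * (n : ℝ) ^ 2))) < α * ρ)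
    {z : EuclideanSpace ℝ (Fin n)} (hz : z ∈ Q) :
    ∃ y ∈ Q, z + α • (y - z) ∈ Q ∧ ∃ k < N, (trajectory Q sep g c R k).1 ∈ Q ∧
      0 < inner ℝ (g k (trajectory Q sep g c R k).1)
        (z + α • (y - z) - (trajectory Q sep g c R k).1) := by
  have hmem : ∀ y ∈ Q, z + α • (y - z) ∈ Q := fun y hy =>
    hconv.add_smul_sub_mem hz hy ⟨hα0.le, hα1⟩
  suffices h : ∃ y ∈ Q, z + α • (y - z) ∉ ellipsoid (trajectory Q sep g c R N) by
    obtain ⟨y, hy, hyN⟩ := h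
    exact ⟨y, hy, hmem y hy,
      exists_cut_of_notMem_ellipsoid hn hR hQ hsep hrun (hmem y hy) hyN⟩
  by_contra! hcon
  have hsub : AffineMap.homothety z α '' Metric.closedBall x₀ ρ ⊆
      ellipsoid (trajectory Q sep g c R N) := by
    rintro _ ⟨y, hy, rfl⟩
    have := hcon y (hball hy)
    rwa [AffineMap.homothety_apply, vsub_eq_sub, vadd_eq_add, add_comm]
  have hpos := trajectory_posDef hn hR hsep hrun le_rfl
  have hvol := measure_mono (μ := volume) hsub
  rw [Measure.addHaar_image_homothety, volume_ellipsoid hpos,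
    Measure.addHaar_closedBall _ _ hρ.le, ← mul_assoc,
    ENNReal.mul_le_mul_iff_left (Metric.measure_ball_pos volume _ one_pos).ne'
      measure_ball_lt_top.ne, finrank_euclideanSpace_fin, abs_of_pos (by positivity),
    ← ENNReal.ofReal_mul (by positivity), ENNReal.ofReal_le_ofReal_iff (Real.sqrt_nonneg _),
    ← mul_pow] at hvol
  have hdet : √(trajectory Q sep g c R N).2.det ≤
      (R * Real.exp (-(N / (2 * (n : ℝ) ^ 2)))) ^ n := by
    refine (Real.sqrt_le_sqrt (trajectory_det_le hn hR hsep hrun le_rfl)).trans_eq ?_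
    rw [mul_comm 2 n, pow_mul, Real.sqrt_sq (by positivity)]
  exact absurd (hvol.trans hdet) (not_le.2 (pow_lt_pow_left₀ hlt (by positivity) (by omega)))

lemma exists_isOutput (hn : 2 ≤ n) (hR : 0 < R) (hQ : Q ⊆ Metric.closedBall c R)
    (hconv : Convex ℝ Q) (hsep : IsSeparationOracle Q sep)
    {x₀ : EuclideanSpace ℝ (Fin n)} {ρ : ℝ} (hρ : 0 < ρ) (hball : Metric.closedBall x₀ ρ ⊆ Q)
    (hlt : R * Real.exp (-(N / (2 * (n : ℝ) ^ 2))) < ρ) (f : EuclideanSpace ℝ (Fin n) → ℝ) :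
    ∃ x, IsOutput Q f sep g c R N x := by
  classical
  by_cases hrun : ∃ k, k < N ∧ StopsAt Q sep g c R k
  · refine ⟨_, Or.inl ⟨Nat.find hrun, (Nat.find_spec hrun).1, (Nat.find_spec hrun).2, ?_, rfl⟩⟩
    intro j hj hs
    exact Nat.find_min hrun hj ⟨hj.trans (Nat.find_spec hrun).1, hs⟩
  · have hrun' : ∀ k < N, ¬ StopsAt Q sep g c R k := fun k hk hs => hrun ⟨k, hk, hs⟩
    obtain ⟨y, -, -, k, hk, hkQ, -⟩ := exists_cut hn hR hQ hconv hsep hrun' hρ hball one_pos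
      le_rfl (by rwa [one_mul]) (hball (Metric.mem_closedBall_self hρ.le))
    obtain ⟨j, hj, hmin⟩ := ((Finset.range (N + 1)).filter
      fun i => (trajectory Q sep g c R i).1 ∈ Q).exists_min_image
      (fun i => f (trajectory Q sep g c R i).1)
      ⟨k, by simp only [Finset.mem_filter, Finset.mem_range]; exact ⟨by omega, hkQ⟩⟩
    simp only [Finset.mem_filter, Finset.mem_range] at hj hmin
    exact ⟨_, Or.inr ⟨hrun', hj.2, ⟨j, by omega, rfl⟩,
      fun i hi hiQ => hmin i ⟨by omega, hiQ⟩⟩⟩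

lemma IsOutput.mem {f : EuclideanSpace ℝ (Fin n) → ℝ} {x : EuclideanSpace ℝ (Fin n)}
    (h : IsOutput Q f sep g c R N x) : x ∈ Q := by
  rcases h with ⟨k, -, hs, -, rfl⟩ | ⟨-, hx, -⟩
  · exact hs.1
  · exact hx

/-- An answer at distance at most `τ` from a subgradient is a `τ D`-subgradient, `D` being a bound
for the diameter of `Q`. -/
lemma IsSubgradient.isDeltaSubgradient {f : EuclideanSpace ℝ (Fin n) → ℝ} {D τ : ℝ}
    {x m w : EuclideanSpace ℝ (Fin n)} (hm : IsSubgradient Q f x m)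
    (hD : ∀ y ∈ Q, ‖y - x‖ ≤ D) (hτ : ‖w - m‖ ≤ τ) : IsDeltaSubgradient Q f (τ * D) x w := by
  intro y hy
  have h1 := hm y hy
  have h2 : inner ℝ (w - m) (y - x) ≤ τ * D :=
    (real_inner_le_norm _ _).trans
      (mul_le_mul hτ (hD y hy) (norm_nonneg _) ((norm_nonneg _).trans hτ))
  rw [inner_sub_left] at h2
  linarith

/-- Accuracy of the ellipsoid method with a `δ`-subgradient oracle. -/
lemma IsOutput.le_add (hn : 2 ≤ n) (hR : 0 < R) (hQ : Q ⊆ Metric.closedBall c R)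
    (hsep : IsSeparationOracle Q sep)
    {x₀ : EuclideanSpace ℝ (Fin n)} {ρ : ℝ} (hρ : 0 < ρ) (hball : Metric.closedBall x₀ ρ ⊆ Q)
    {α : ℝ} (hα0 : 0 < α) (hα1 : α ≤ 1) (hlt : R * Real.exp (-(N / (2 * (n : ℝ) ^ 2))) < α * ρ)
    {f : EuclideanSpace ℝ (Fin n) → ℝ} (hf : ConvexOn ℝ Q f) {B δ : ℝ} (hB : 0 ≤ B)
    {z : EuclideanSpace ℝ (Fin n)} (hz : z ∈ Q) (hosc : ∀ y ∈ Q, f y - f z ≤ B)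
    (hg : ∀ k < N, (trajectory Q sep g c R k).1 ∈ Q →
      IsDeltaSubgradient Q f δ (trajectory Q sep g c R k).1 (g k (trajectory Q sep g c R k).1))
    {x : EuclideanSpace ℝ (Fin n)} (h : IsOutput Q f sep g c R N x) :
    f x ≤ f z + α * B + δ := by
  rcases h with ⟨k, hk, hs, -, rfl⟩ | ⟨hrun, hx, -, hmin⟩
  · have h1 := hg k hk hs.1 z hz
    rw [hs.2, inner_zero_left] at h1
    nlinarith [mul_nonneg hα0.le hB]
  · obtain ⟨y, hy, hyα, k, hk, hkQ, hcut⟩ :=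
      exists_cut hn hR hQ hf.1 hsep hrun hρ hball hα0 hα1 hlt hz
    have h1 := hg k hk hkQ _ hyα
    have h2 := hmin k hk.le hkQ
    have h3 := hf.2 hz hy (sub_nonneg.2 hα1) hα0.le (by ring)
    rw [show (1 - α) • z + α • y = z + α • (y - z) by module] at h3
    simp only [smul_eq_mul] at h3
    nlinarith [mul_le_mul_of_nonneg_left (hosc y hy) hα0.le]

end Trajectory

/-! ### The starting ball and the number of iterations -/

/-- The ball around the midpoint of a diameter contains the set, by the parallelogram law. -/
lemma exists_closedBall_of_diam {E : Type*} [NormedAddCommGroup E] [InnerProductSpace ℝ E]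
    {K : Set E} (hK : IsCompact K) (hne : K.Nonempty) :
    ∃ (c : E) (R : ℝ), K ⊆ Metric.closedBall c R ∧ R ≤ √3 / 2 * Metric.diam K := by
  obtain ⟨p, hp, hmax⟩ := (hK.prod hK).exists_isMaxOn (hne.prod hne)
    (f := fun p : E × E => dist p.1 p.2) (by fun_prop)
  have hdiam : Metric.diam K = dist p.1 p.2 := by
    refine le_antisymm (Metric.diam_le_of_forall_dist_le dist_nonneg fun x hx y hy => ?_)
      (Metric.dist_le_diam_of_mem hK.isBounded hp.1 hp.2)
    exact hmax (Set.mk_mem_prod hx hy)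
  refine ⟨(2⁻¹ : ℝ) • (p.1 + p.2), √3 / 2 * Metric.diam K, fun z hz => ?_, le_rfl⟩
  have h1 : ‖z - p.1‖ ≤ Metric.diam K := by
    rw [← dist_eq_norm]; exact Metric.dist_le_diam_of_mem hK.isBounded hz hp.1
  have h2 : ‖z - p.2‖ ≤ Metric.diam K := by
    rw [← dist_eq_norm]; exact Metric.dist_le_diam_of_mem hK.isBounded hz hp.2
  have h3 := parallelogram_law_with_norm ℝ (z - p.1) (z - p.2)
  have h4 : ‖z - p.1 - (z - p.2)‖ = Metric.diam K := by
    rw [hdiam, dist_comm, dist_eq_norm]; congr 1; abel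
  have h5 : ‖z - p.1 + (z - p.2)‖ = 2 * ‖z - (2⁻¹ : ℝ) • (p.1 + p.2)‖ := by
    rw [show z - p.1 + (z - p.2) = (2 : ℝ) • (z - (2⁻¹ : ℝ) • (p.1 + p.2)) by module, norm_smul]
    simp
  rw [h4, h5] at h3
  have hd0 : 0 ≤ Metric.diam K := Metric.diam_nonneg
  rw [Metric.mem_closedBall, dist_eq_norm]
  refine abs_le_of_sq_le_sq' ?_ (by positivity) |>.2
  have h6 : (√3 / 2 * Metric.diam K) ^ 2 = 3 / 4 * Metric.diam K ^ 2 := by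
    rw [mul_pow, div_pow, Real.sq_sqrt (by norm_num)]; norm_num
  rw [h6]
  nlinarith [norm_nonneg (z - p.1), norm_nonneg (z - p.2)]

/-- A set that contains a ball of radius `ρ` has diameter at least `2 ρ`. -/
lemma two_mul_le_diam {n : ℕ} (hn : 2 ≤ n) {K : Set (EuclideanSpace ℝ (Fin n))}
    (hK : Bornology.IsBounded K) {x₀ : EuclideanSpace ℝ (Fin n)} {ρ : ℝ} (hρ : 0 ≤ ρ)
    (hball : Metric.closedBall x₀ ρ ⊆ K) : 2 * ρ ≤ Metric.diam K := by
  obtain ⟨v, hv⟩ : ∃ v : EuclideanSpace ℝ (Fin n), ‖v‖ = ρ :=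
    ⟨EuclideanSpace.single ⟨0, by omega⟩ ρ, by simp [abs_of_nonneg hρ]⟩
  have h1 : x₀ + v ∈ K := hball (by simp [hv])
  have h2 : x₀ - v ∈ K := hball (by simp [hv])
  have h3 := Metric.dist_le_diam_of_mem hK h1 h2
  rwa [dist_eq_norm, show x₀ + v - (x₀ - v) = (2 : ℝ) • v by module, norm_smul, hv,
    Real.norm_of_nonneg zero_le_two] at h3

lemma one_le_iterations {n : ℕ} (hn : 2 ≤ n) {D B ρ ε : ℝ} (hρ : 0 < ρ) (hε : 0 < ε)
    (hD : 2 * ρ ≤ D) (hB : ε ≤ B) :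
    1 ≤ iterations n D B ρ ε ∧
      (iterations n D B ρ ε : ℝ) ≤ 2 * (n : ℝ) ^ 2 * Real.log (D * B / (ρ * ε)) := by
  have hn' : (2 : ℝ) ≤ n := by exact_mod_cast hn
  have h1 : (2 : ℝ) ≤ D * B / (ρ * ε) := by
    rw [le_div_iff₀ (by positivity), ← mul_assoc]
    exact mul_le_mul hD hB hε.le (by linarith)
  have h2 : Real.log 2 ≤ Real.log (D * B / (ρ * ε)) := Real.log_le_log (by norm_num) h1
  have h3 := Real.log_two_gt_d9
  have h4 : 1 ≤ 2 * (n : ℝ) ^ 2 * Real.log (D * B / (ρ * ε)) := by nlinarith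
  exact ⟨Nat.le_floor (by exact_mod_cast h4), Nat.floor_le (by linarith)⟩

/-- After `⌊2 n² ln (D B / (ρ ε))⌋` steps the radius of a ball with the volume of the ellipsoid is
below `99 ε / (100 B) * ρ`: rounding costs a factor `exp (1 / (2 n²)) ≤ exp (1 / 8)`, and
`√3 / 2 * exp (1 / 8) < 99 / 100`. -/
lemma radius_mul_exp_lt {n : ℕ} (hn : 2 ≤ n) {D B ρ ε R : ℝ} (hρ : 0 < ρ) (hε : 0 < ε)
    (hD : 0 < D) (hB : 0 < B) (hR : R ≤ √3 / 2 * D) :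
    R * Real.exp (-(iterations n D B ρ ε / (2 * (n : ℝ) ^ 2))) < 99 / 100 * (ε / B) * ρ := by
  have hn' : (2 : ℝ) ≤ n := by exact_mod_cast hn
  have hfl := Nat.lt_floor_add_one (2 * (n : ℝ) ^ 2 * Real.log (D * B / (ρ * ε)))
  have hn2 : (0 : ℝ) < 2 * (n : ℝ) ^ 2 := by positivity
  have h1 : -(iterations n D B ρ ε / (2 * (n : ℝ) ^ 2)) ≤
      1 / 8 - Real.log (D * B / (ρ * ε)) := by
    have h2 : Real.log (D * B / (ρ * ε)) ≤
        (iterations n D B ρ ε + 1) / (2 * (n : ℝ) ^ 2) := by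
      rw [le_div_iff₀ hn2, mul_comm]; exact hfl.le
    have h3 : 1 / (2 * (n : ℝ) ^ 2) ≤ 1 / 8 :=
      one_div_le_one_div_of_le (by norm_num) (by nlinarith)
    rw [add_div] at h2
    linarith
  have h4 : Real.exp (-(iterations n D B ρ ε / (2 * (n : ℝ) ^ 2))) ≤
      Real.exp (1 / 8) * (ρ * ε / (D * B)) := by
    refine (Real.exp_le_exp.2 h1).trans_eq ?_
    rw [Real.exp_sub, Real.exp_log (by positivity), div_div_eq_mul_div, mul_div_assoc]
  have h5 : √3 / 2 * Real.exp (1 / 8) < 99 / 100 := by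
    have e1 : Real.exp (1 / 8) ^ 8 < (2.7182818286 : ℝ) := by
      rw [← Real.exp_nat_mul]
      refine lt_of_eq_of_lt ?_ Real.exp_one_lt_d9
      norm_num
    have e2 : Real.exp (1 / 8) < 1.14 :=
      lt_of_pow_lt_pow_left₀ 8 (by norm_num) (e1.trans (by norm_num))
    have e3 : √3 < 1.7321 := (Real.sqrt_lt' (by norm_num)).2 (by norm_num)
    nlinarith [Real.sqrt_nonneg 3, Real.exp_pos (1 / 8)]
  calc R * Real.exp (-(iterations n D B ρ ε / (2 * (n : ℝ) ^ 2)))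
      ≤ (√3 / 2 * D) * (Real.exp (1 / 8) * (ρ * ε / (D * B))) :=
        mul_le_mul hR h4 (Real.exp_pos _).le (by positivity)
    _ = √3 / 2 * Real.exp (1 / 8) * (ε / B * ρ) := by field_simp
    _ < 99 / 100 * (ε / B * ρ) := mul_lt_mul_of_pos_right h5 (by positivity)
    _ = _ := by ring

/-! ### The stochastic oracle along the random trajectory -/

/-- The shape matrix is described by its entries because `Matrix` carries no σ-algebra. -/
lemma measurable_ellipsoidUpdate {Ω : Type*} [MeasurableSpace Ω] {n : ℕ}
    {e : Ω → EllipsoidData n} {w : Ω → EuclideanSpace ℝ (Fin n)}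
    (he1 : Measurable fun ω => (e ω).1) (he2 : ∀ i j, Measurable fun ω => (e ω).2 i j)
    (hw : Measurable w) :
    (Measurable fun ω => (ellipsoidUpdate (e ω) (w ω)).1) ∧
      ∀ i j, Measurable fun ω => (ellipsoidUpdate (e ω) (w ω)).2 i j := by
  have hwi : ∀ i, Measurable fun ω => (w ω).ofLp i := fun i => by fun_prop
  have hmv : ∀ i, Measurable fun ω => ((e ω).2.mulVec (w ω).ofLp) i := fun i => by
    simp only [Matrix.mulVec, dotProduct]
    exact Finset.measurable_fun_sum _ fun j _ => (he2 i j).mul (hwi j)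
  have hq : Measurable fun ω => (w ω).ofLp ⬝ᵥ ((e ω).2.mulVec (w ω).ofLp) := by
    simp only [dotProduct]
    exact Finset.measurable_fun_sum _ fun j _ => (hwi j).mul (hmv j)
  have hM : ∀ i j, Measurable fun ω =>
      ((e ω).2 * Matrix.vecMulVec (w ω).ofLp (w ω).ofLp * (e ω).2) i j := fun i j => by
    simp only [Matrix.mul_apply, Matrix.vecMulVec_apply]
    exact Finset.measurable_fun_sum _ fun k _ => (Finset.measurable_fun_sum _ fun l _ =>
      (he2 i l).mul ((hwi l).mul (hwi k))).mul (he2 k j)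
  constructor
  · simp only [ellipsoidUpdate]
    have hs : Measurable fun ω =>
        1 / ((n : ℝ) + 1) / √((w ω).ofLp ⬝ᵥ ((e ω).2.mulVec (w ω).ofLp)) := by fun_prop
    exact he1.sub (hs.smul ((WithLp.measurable_toLp 2 _).comp (measurable_pi_iff.2 hmv)))
  · intro i j
    simp only [ellipsoidUpdate, Matrix.smul_apply, Matrix.sub_apply, smul_eq_mul]
    exact ((he2 i j).sub (Measurable.mul (by fun_prop) (hM i j))).const_mul _

lemma measurable_minibatch {n : ℕ} {Ω Ξ : Type*} [MeasurableSpace Ω] [MeasurableSpace Ξ]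
    {G : EuclideanSpace ℝ (Fin n) → Ξ → EuclideanSpace ℝ (Fin n)}
    (hG : Measurable fun p : EuclideanSpace ℝ (Fin n) × Ξ => G p.1 p.2) (r : ℕ)
    {x : Ω → EuclideanSpace ℝ (Fin n)} (hx : Measurable x) {z : ℕ → Ω → Ξ}
    (hz : ∀ l, Measurable (z l)) : Measurable fun ω => minibatch G r (fun l => z l ω) (x ω) := by
  have h : Measurable fun ω => ∑ l ∈ Finset.range r, G (x ω) (z l ω) :=
    Finset.measurable_fun_sum _ fun l _ => hG.comp (hx.prodMk (hz l))
  exact h.const_smul (1 / (r : ℝ))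

/-- The ellipsoid of step `k` is a function of the realizations of the previous steps only: it is
measurable for every σ-algebra that makes these measurable. -/
lemma measurable_trajectory {n : ℕ} {Ω Ξ : Type*} [MeasurableSpace Ω] [MeasurableSpace Ξ]
    {Q : Set (EuclideanSpace ℝ (Fin n))} (hQ : IsClosed Q)
    {sep : EllipsoidData n → EuclideanSpace ℝ (Fin n)} (hsep : IsSeparationOracle Q sep)
    {G : EuclideanSpace ℝ (Fin n) → Ξ → EuclideanSpace ℝ (Fin n)}
    (hG : Measurable fun p : EuclideanSpace ℝ (Fin n) × Ξ => G p.1 p.2) (r : ℕ)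
    (c : EuclideanSpace ℝ (Fin n)) (R : ℝ) {ξ : ℕ × ℕ → Ω → Ξ} (k : ℕ)
    (hξ : ∀ j < k, ∀ l, Measurable (ξ (j, l))) :
    (Measurable fun ω =>
      (trajectory Q sep (fun k => minibatch G r fun l => ξ (k, l) ω) c R k).1) ∧
    ∀ i j, Measurable fun ω =>
      (trajectory Q sep (fun k => minibatch G r fun l => ξ (k, l) ω) c R k).2 i j := by
  induction k with
  | zero => exact ⟨measurable_const, fun i j => measurable_const⟩
  | succ k ih =>
    obtain ⟨h1, h2⟩ := ih fun j hj => hξ j (by omega)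
    refine measurable_ellipsoidUpdate h1 h2 ?_
    simp only [direction]
    refine Measurable.ite (h1 hQ.measurableSet) ?_ ?_
    · exact measurable_minibatch hG r h1 (hξ k (by omega))
    · exact hsep.measurable.comp
        (h1.prodMk (measurable_pi_iff.2 fun i => measurable_pi_iff.2 fun j => h2 i j))

lemma measure_lt_norm_minibatch_sub_le {n : ℕ} {Ω Ξ : Type*} [MeasurableSpace Ω]
    [MeasurableSpace Ξ] {P : Measure Ξ} [IsProbabilityMeasure P] {μ : Measure Ω}
    [IsProbabilityMeasure μ] {Q : Set (EuclideanSpace ℝ (Fin n))}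
    {f : EuclideanSpace ℝ (Fin n) → ℝ} {σ : ℝ} (hσ : 0 < σ)
    {G : EuclideanSpace ℝ (Fin n) → Ξ → EuclideanSpace ℝ (Fin n)}
    (hG : IsStochasticOracle P Q f σ G) {ζ : ℕ → Ω → Ξ} (hζ : ∀ l, Measurable (ζ l))
    (hlaw : ∀ l, μ.map (ζ l) = P) (hind : iIndepFun ζ μ) {x : EuclideanSpace ℝ (Fin n)}
    (hx : x ∈ Q) {τ : ℝ} (hτ : 0 < τ) {r : ℕ} (hr : 0 < r) :
    μ {ω | τ < ‖minibatch G r (fun l => ζ l ω) x - ∫ z, G x z ∂P‖} ≤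
      ENNReal.ofReal (2 * Real.exp (-(r * τ ^ 2 / (20 * σ ^ 2)))) := by
  obtain ⟨g, -, hg⟩ := hG.lightTail x hx
  have hGx : Measurable (G x) := hG.measurable.comp (measurable_const.prodMk measurable_id)
  obtain ⟨hint, hexp, hle⟩ := lightTail_around_mean hGx hσ hg
  obtain ⟨m, hm⟩ : ∃ m, m = ∫ z, G x z ∂P := ⟨_, rfl⟩
  rw [← hm] at hexp hle ⊢
  have hYm : Measurable fun z => G x z - m := hGx.sub_const m
  have hEm : Measurable fun z => Real.exp (‖G x z - m‖ ^ 2 / (2 * σ) ^ 2) := by fun_prop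
  have hmp : ∀ l, MeasurePreserving (ζ l) μ P := fun l => ⟨hζ l, hlaw l⟩
  have key := measure_lt_norm_average_le (X := fun l ω => G x (ζ l ω) - m)
    (fun l => hYm.comp (hζ l)) (hind.comp (fun _ z => G x z - m) fun _ => hYm)
    (mul_pos two_pos hσ)
    (fun l => (hmp l).integrable_comp_of_integrable (hint.sub (integrable_const m)))
    (fun l => by
      rw [← integral_map (f := fun z => G x z - m) (hζ l).aemeasurable
        hYm.aestronglyMeasurable, hlaw, integral_sub hint (integrable_const m), ← hm]
      simp)
    (fun l => (hmp l).integrable_comp_of_integrable hexp)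
    (fun l => by
      rwa [← integral_map (f := fun z => Real.exp (‖G x z - m‖ ^ 2 / (2 * σ) ^ 2))
        (hζ l).aemeasurable hEm.aestronglyMeasurable, hlaw]) hτ hr
  have hr' : (r : ℝ) ≠ 0 := by exact_mod_cast hr.ne'
  have hsum : ∀ ω, (1 / (r : ℝ)) • ∑ l ∈ Finset.range r, (G x (ζ l ω) - m) =
      minibatch G r (fun l => ζ l ω) x - m := by
    intro ω
    rw [minibatch, Finset.sum_sub_distrib, Finset.sum_const, Finset.card_range, smul_sub,
      ← Nat.cast_smul_eq_nsmul ℝ, smul_smul, one_div_mul_cancel hr', one_smul]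
  simp only [hsum] at key
  refine key.trans_eq ?_
  rw [mul_pow]
  ring_nf

/-- The deviation bound at the random centre of step `k`: the centre is independent of the batch
of that step, so that the bound for a fixed point applies conditionally. -/
lemma measure_lt_norm_minibatch_trajectory_sub_le {n : ℕ} {Ω Ξ : Type*} [MeasurableSpace Ω]
    [MeasurableSpace Ξ] {P : Measure Ξ} [IsProbabilityMeasure P] {μ : Measure Ω}
    [IsProbabilityMeasure μ] {Q : Set (EuclideanSpace ℝ (Fin n))} (hQ : IsClosed Q)
    {f : EuclideanSpace ℝ (Fin n) → ℝ} {σ : ℝ} (hσ : 0 < σ)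
    {G : EuclideanSpace ℝ (Fin n) → Ξ → EuclideanSpace ℝ (Fin n)}
    (hG : IsStochasticOracle P Q f σ G)
    {sep : EllipsoidData n → EuclideanSpace ℝ (Fin n)} (hsep : IsSeparationOracle Q sep)
    {ξ : ℕ × ℕ → Ω → Ξ} (hξ : ∀ p, Measurable (ξ p)) (hlaw : ∀ p, μ.map (ξ p) = P)
    (hind : iIndepFun ξ μ) (c : EuclideanSpace ℝ (Fin n)) (R : ℝ) (k : ℕ)
    {τ : ℝ} (hτ : 0 < τ) {r : ℕ} (hr : 0 < r) :
    μ {ω | (trajectory Q sep (fun k => minibatch G r fun l => ξ (k, l) ω) c R k).1 ∈ Q ∧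
        τ < ‖minibatch G r (fun l => ξ (k, l) ω)
            (trajectory Q sep (fun k => minibatch G r fun l => ξ (k, l) ω) c R k).1 -
          ∫ z, G (trajectory Q sep (fun k => minibatch G r fun l => ξ (k, l) ω) c R k).1 z ∂P‖} ≤
      ENNReal.ofReal (2 * Real.exp (-(r * τ ^ 2 / (20 * σ ^ 2)))) := by
  set X : Ω → EuclideanSpace ℝ (Fin n) := fun ω =>
    (trajectory Q sep (fun k => minibatch G r fun l => ξ (k, l) ω) c R k).1 with hX
  set Z : Ω → ℕ → Ξ := fun ω l => ξ (k, l) ω with hZ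
  have hXm : Measurable X :=
    (measurable_trajectory hQ hsep hG.measurable r c R k fun j _ l => hξ (j, l)).1
  have hZm : Measurable Z := measurable_pi_iff.2 fun l => hξ (k, l)
  have hXZ : IndepFun X Z μ := by
    have hdisj : Disjoint {p : ℕ × ℕ | p.1 < k} {p : ℕ × ℕ | p.1 = k} :=
      Set.disjoint_left.2 fun p (h1 : p.1 < k) (h2 : p.1 = k) => h1.ne h2
    have h := indep_iSup_of_disjoint (fun p => (hξ p).comap_le) hind hdisj
    refine indep_of_indep_of_le_left (indep_of_indep_of_le_right h ?_) ?_
    · refine Measurable.comap_le (@measurable_pi_iff _ _ _ (_) _ _ |>.2 fun l => ?_)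
      exact measurable_iff_comap_le.2
        (le_iSup₂_of_le (f := fun p (_ : p ∈ {p : ℕ × ℕ | p.1 = k}) =>
          MeasurableSpace.comap (ξ p) inferInstance) (k, l) rfl le_rfl)
    · refine Measurable.comap_le ?_
      refine (@measurable_trajectory n Ω Ξ (_) _ Q hQ sep hsep G hG.measurable r c R ξ k ?_).1
      intro j hj l
      exact measurable_iff_comap_le.2
        (le_iSup₂_of_le (f := fun p (_ : p ∈ {p : ℕ × ℕ | p.1 < k}) =>
          MeasurableSpace.comap (ξ p) inferInstance) (j, l) hj le_rfl)
  have hS : MeasurableSet {p : EuclideanSpace ℝ (Fin n) × (ℕ → Ξ) |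
      p.1 ∈ Q ∧ τ < ‖minibatch G r p.2 p.1 - ∫ z, G p.1 z ∂P‖} := by
    have h1 : Measurable fun p : EuclideanSpace ℝ (Fin n) × (ℕ → Ξ) => minibatch G r p.2 p.1 :=
      measurable_minibatch hG.measurable r measurable_fst 
        (z := fun l (p : EuclideanSpace ℝ (Fin n) × (ℕ → Ξ)) => p.2 l)
        fun l => (measurable_pi_apply l).comp measurable_snd
    have h2 : Measurable fun x : EuclideanSpace ℝ (Fin n) => ∫ z, G x z ∂P :=
      (StronglyMeasurable.integral_prod_right hG.measurable.stronglyMeasurable).measurable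
    exact (measurable_fst hQ.measurableSet).inter
      (measurableSet_lt measurable_const (h1.sub (h2.comp measurable_fst)).norm)
  have hmap := (indepFun_iff_map_prod_eq_prod_map_map hXm.aemeasurable hZm.aemeasurable).1 hXZ
  have : IsProbabilityMeasure (μ.map X) := Measure.isProbabilityMeasure_map hXm.aemeasurable
  have : IsProbabilityMeasure (μ.map Z) := Measure.isProbabilityMeasure_map hZm.aemeasurable
  calc _ = μ.map (fun ω => (X ω, Z ω)) {p | p.1 ∈ Q ∧
          τ < ‖minibatch G r p.2 p.1 - ∫ z, G p.1 z ∂P‖} := by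
        rw [Measure.map_apply (hXm.prodMk hZm) hS]; rfl
    _ ≤ ∫⁻ _, ENNReal.ofReal (2 * Real.exp (-(r * τ ^ 2 / (20 * σ ^ 2)))) ∂(μ.map X) := by
        rw [hmap, Measure.prod_apply hS]
        refine lintegral_mono fun x => ?_
        rw [Measure.map_apply hZm (measurable_prodMk_left hS)]
        by_cases hx : x ∈ Q
        · refine (measure_mono fun ω hω => ?_).trans
            (measure_lt_norm_minibatch_sub_le hσ hG (ζ := fun l => ξ (k, l))
              (fun l => hξ (k, l)) (fun l => hlaw (k, l))
              (hind.precomp (Prod.mk_right_injective k)) hx hτ hr)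
          exact hω.2
        · refine (measure_mono_null (fun ω hω => hx hω.1) measure_empty).trans_le zero_le
    _ = _ := by simp

/-- The union bound over the steps, for the batch size of the theorem. -/
lemma nat_mul_exp_le {N r : ℕ} (hN : 1 ≤ N) {σ D ε β : ℝ} (hσ : 0 < σ) (hD : 0 < D)
    (hε : 0 < ε) (hβ : 0 < β)
    (hr : 200000 * (σ ^ 2 * D ^ 2 / ε ^ 2) * (1 + Real.log (N / β)) ≤ r) :
    N * (2 * Real.exp (-(r * (ε / (100 * D)) ^ 2 / (20 * σ ^ 2)))) ≤ β := by
  have hN' : (0 : ℝ) < N := by exact_mod_cast hN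
  have h1 : 1 + Real.log (N / β) ≤ r * (ε / (100 * D)) ^ 2 / (20 * σ ^ 2) := by
    calc 1 + Real.log (N / β) = 200000 * (σ ^ 2 * D ^ 2 / ε ^ 2) * (1 + Real.log (N / β)) *
          (ε / (100 * D)) ^ 2 / (20 * σ ^ 2) := by field_simp; ring
      _ ≤ _ := by gcongr
  have h2 : Real.exp (-(r * (ε / (100 * D)) ^ 2 / (20 * σ ^ 2))) ≤ Real.exp (-1) * (β / N) := by
    refine (Real.exp_le_exp.2 (neg_le_neg h1)).trans_eq ?_
    rw [neg_add, Real.exp_add, Real.exp_neg (Real.log _), Real.exp_log (by positivity), inv_div]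
  have h3 : 2 * Real.exp (-1) ≤ 1 := by
    have := Real.add_one_le_exp (1 : ℝ)
    rw [Real.exp_neg, ← div_eq_mul_inv, div_le_one (Real.exp_pos 1)]
    linarith
  calc N * (2 * Real.exp (-(r * (ε / (100 * D)) ^ 2 / (20 * σ ^ 2))))
      ≤ N * (2 * (Real.exp (-1) * (β / N))) := by gcongr
    _ = 2 * Real.exp (-1) * β := by field_simp
    _ ≤ β := by nlinarith

end StochEllipsoid

theorem theorem2 :
    ∃ C : ℝ, 0 < C ∧
      ∀ (n : ℕ) (_ : 2 ≤ n)
        -- the feasible set, with its diameter `D` and an inscribed ball of radius `ρ`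
        (Q : Set (EuclideanSpace ℝ (Fin n))) (_ : IsCompact Q) (_ : Convex ℝ Q)
        (D : ℝ) (_ : D = Metric.diam Q)
        (x₀ : EuclideanSpace ℝ (Fin n)) (ρ : ℝ) (_ : 0 < ρ) (_ : Metric.closedBall x₀ ρ ⊆ Q)
        -- the law of `ξ` and the objective, with its oscillation `B` on `Q`
        (Ξ : Type*) (_ : MeasurableSpace Ξ) (P : Measure Ξ) (_ : IsProbabilityMeasure P)
        (F : EuclideanSpace ℝ (Fin n) → Ξ → ℝ) (_ : ∀ x ∈ Q, Integrable (F x) P)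
        (f : EuclideanSpace ℝ (Fin n) → ℝ) (_ : f = StochEllipsoid.expectedValue P F)
        (_ : ContinuousOn f Q) (_ : ConvexOn ℝ Q f)
        (B : ℝ) (_ : B = Metric.diam (f '' Q))
        -- the stochastic subgradient oracle and the separation oracle
        (σ : ℝ) (_ : 0 < σ)
        (G : EuclideanSpace ℝ (Fin n) → Ξ → EuclideanSpace ℝ (Fin n))
        (_ : StochEllipsoid.IsStochasticOracle P Q f σ G)
        (sep : StochEllipsoid.EllipsoidData n → EuclideanSpace ℝ (Fin n))
        (_ : StochEllipsoid.IsSeparationOracle Q sep)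
        -- the accuracy, the confidence level and the number of iterations
        (ε : ℝ) (_ : 0 < ε) (_ : ε ≤ B) (β : ℝ) (_ : 0 < β) (_ : β < 1)
        (N : ℕ) (_ : N = StochEllipsoid.iterations n D B ρ ε)
        -- the batch size
        (r : ℕ) (_ : C * (σ ^ 2 * D ^ 2 / ε ^ 2) * (1 + Real.log (N / β)) ≤ r)
        -- the independent realizations of `ξ`, the `l`-th one of step `k` being `ξ (k, l)`
        (Ω : Type*) (_ : MeasurableSpace Ω) (μ : Measure Ω) (_ : IsProbabilityMeasure μ)
        (ξ : ℕ × ℕ → Ω → Ξ) (_ : ∀ p, Measurable (ξ p)) (_ : ∀ p, μ.map (ξ p) = P)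
        (_ : iIndepFun ξ μ),
        1 ≤ N ∧ (N : ℝ) ≤ 2 * (n : ℝ) ^ 2 * Real.log (D * B / (ρ * ε)) ∧
        (∃ (c : EuclideanSpace ℝ (Fin n)) (R : ℝ),
          Q ⊆ Metric.closedBall c R ∧ R ≤ Real.sqrt 3 / 2 * D) ∧
        ∀ (c : EuclideanSpace ℝ (Fin n)) (R : ℝ),
          Q ⊆ Metric.closedBall c R → R ≤ Real.sqrt 3 / 2 * D →
          (∀ ω, ∃ x, StochEllipsoid.IsOutput Q f sep
            (fun k => StochEllipsoid.minibatch G r fun l => ξ (k, l) ω) c R N x) ∧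
          ∀ xhat : Ω → EuclideanSpace ℝ (Fin n),
            (∀ ω, StochEllipsoid.IsOutput Q f sep
              (fun k => StochEllipsoid.minibatch G r fun l => ξ (k, l) ω) c R N (xhat ω)) →
            StochEllipsoid.IsEpsBetaSolution μ Q f ε β xhat := by
  refine ⟨200000, by norm_num, ?_⟩
  intro n hn Q hQc hQconv D hD x₀ ρ hρ hball Ξ _ P _ F _ f _ hfc hfconv B hB σ hσ G hG sep hsep
    ε hε hεB β hβ hβ1 N hN r hr Ω _ μ _ ξ hξ hlaw hind
  have hne : Q.Nonempty := ⟨x₀, hball (Metric.mem_closedBall_self hρ.le)⟩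
  have hDρ : 2 * ρ ≤ D := hD ▸ StochEllipsoid.two_mul_le_diam hn hQc.isBounded hρ.le hball
  have hD0 : 0 < D := by linarith
  have hB0 : 0 < B := by linarith
  obtain ⟨hN1, hN2⟩ := StochEllipsoid.one_le_iterations hn hρ hε hDρ hεB
  rw [← hN] at hN1 hN2
  refine ⟨hN1, hN2, hD ▸ StochEllipsoid.exists_closedBall_of_diam hQc hne, ?_⟩
  intro c R hQR hR
  have hR0 : 0 < R := by
    have h0 : 0 ≤ R := Metric.nonempty_closedBall.1 (hne.mono hQR)
    have h1 := (Metric.diam_mono hQR Metric.isBounded_closedBall).trans (Metric.diam_closedBall h0)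
    rw [← hD] at h1
    linarith
  have hlt := StochEllipsoid.radius_mul_exp_lt hn hρ hε hD0 hB0 hR
  rw [← hN] at hlt
  have hα0 : 0 < 99 / 100 * (ε / B) := by positivity
  have hα1 : 99 / 100 * (ε / B) ≤ 1 := by
    have : ε / B ≤ 1 := (div_le_one hB0).2 hεB
    linarith
  refine ⟨fun ω => StochEllipsoid.exists_isOutput hn hR0 hQR hQconv hsep hρ hball
    (hlt.trans_le (mul_le_of_le_one_left hρ.le hα1)) f, ?_⟩
  intro xhat hout
  refine ⟨fun ω => (hout ω).mem, ?_⟩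
  have hr0 : 0 < r := by
    have h1 : 0 ≤ Real.log (N / β) := by
      refine Real.log_nonneg ((one_le_div hβ).2 ?_)
      have : (1 : ℝ) ≤ N := by exact_mod_cast hN1
      linarith
    have h2 : (0 : ℝ) < r := lt_of_lt_of_le (by positivity) hr
    exact_mod_cast h2
  obtain ⟨z, hz, hzmin⟩ := hQc.exists_isMinOn hne hfc
  have hinf : sInf (f '' Q) = f z :=
    IsLeast.csInf_eq ⟨⟨z, hz, rfl⟩, by rintro _ ⟨y, hy, rfl⟩; exact hzmin hy⟩
  have hosc : ∀ y ∈ Q, f y - f z ≤ B := fun y hy => by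
    rw [hB]
    exact (le_abs_self _).trans (Metric.dist_le_diam_of_mem (hQc.image_of_continuousOn hfc).isBounded
      (Set.mem_image_of_mem f hy) (Set.mem_image_of_mem f hz))
  have hdiam : ∀ x ∈ Q, ∀ y ∈ Q, ‖y - x‖ ≤ D := fun x hx y hy => by
    rw [hD, ← dist_eq_norm]
    exact Metric.dist_le_diam_of_mem hQc.isBounded hy hx
  -- Of the accuracy `ε`, the shrinking factor takes `99 / 100` and the noise takes the rest.
  have hτ : 0 < ε / (100 * D) := by positivity
  refine (measure_mono ?_).trans ((measure_biUnion_finset_le (Finset.range N) _).trans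
    ((Finset.sum_le_sum fun k _ =>
      StochEllipsoid.measure_lt_norm_minibatch_trajectory_sub_le (μ := μ) hQc.isClosed hσ hG hsep hξ
        hlaw hind c R k hτ hr0).trans ?_))
  · intro ω hω
    by_contra hgood
    simp only [Set.mem_iUnion, Finset.mem_range, Set.mem_ofPred_eq, not_exists, not_and,
      not_lt] at hgood
    have h1 := (hout ω).le_add hn hR0 hQR hsep hρ hball hα0 hα1 hlt hfconv hB0.le hz hosc
      (fun k hk hkQ => (hG.mean _ hkQ).isDeltaSubgradient (hdiam _ hkQ) (hgood k hk hkQ))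
    have h2 : 99 / 100 * (ε / B) * B + ε / (100 * D) * D = ε := by field_simp; norm_num
    have h3 : f (xhat ω) - sInf (f '' Q) > ε := hω
    rw [hinf] at h3
    linarith
  · rw [Finset.sum_const, Finset.card_range, nsmul_eq_mul, ← ENNReal.ofReal_natCast,
      ← ENNReal.ofReal_mul (Nat.cast_nonneg N)]
    exact ENNReal.ofReal_le_ofReal (StochEllipsoid.nat_mul_exp_le hN1 hσ hD0 hε hβ hr)
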